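/- Let $m\ge 2$ and $q\ge 2$ be integers and let $\Sigma_m=\{0,\dots,m-1\}^{\mathbb N}$ be the space of sequences $x=(x_k)_{k\ge1}$, with the product topology and the metric $\varrho(x,y)=m^{-\min\{n\ge 1:\,x_n\ne y_n\}+1}$ for $x\ne y$ (and $\varrho(x,x)=0$); $\dim_H$ is the Hausdorff dimension with respect to $\varrho$. For a word $u=u_1\dots u_n$ let $[u]\subset\Sigma_m$ be the set of sequences that start with $u$. For $\Omega\subset\Sigma_m$ put $$X_\Omega=\{(x_k)_{k\ge1}\in\Sigma_m:\ (x_{iq^\ell})_{\ell\ge0}\in\Omega\ \text{ for all } i\ge 1 \text{ with } q\nmid i\}.$$ For a Borel probability measure $\mu$ on $\Omega$ (that is, a Borel probability measure on $\Sigma_m$ with $\mu(\Omega)=1$) let $\mathbb P_\mu$ be the Borel probability measure on $\Sigma_m$ determined by $$\mathbb P_\mu[u]=\prod_{1\le i\le |u|,\ q\nmid i}\mu[u|J_i],\qquad u|J_i=u_iu_{qi}\cdots u_{q^ri},\quad q^ri\le|u|<q^{r+1}i,$$ for all words $u$. The Hausdorff dimension of a Borel probability measure $\mathbb P$ is $\dim_H(\mathbb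 P)=\inf\{\dim_H(F):\ F\text{ Borel},\ \mathbb P(F)=1\}$. For $k\ge1$ let $\alpha_k=\{\Omega\cap[u]:\ u\in\{0,\dots,m-1\}^k,\ \Omega\cap[u]\neq\emptyset\}$, let $H^\mu_m(\alpha_k)=-\sum_{C\in\alpha_k}\mu(C)\log_m\mu(C)$ (with $0\log_m 0=0$), and let $$s(\Omega,\mu)=(q-1)^2\sum_{k=1}^\infty\frac{H^\mu_m(\alpha_k)}{q^{k+1}}.$$ Let $\Omega\subset\Sigma_m$ be closed. Then for every Borel probability measure $\mu$ on $\Omega$ the series defining $s(\Omega,\mu)$ converges and $s(\Omega,\mu)\ge 0$, and $$\dim_H(X_\Omega)=\sup_\mu\dim_H(\mathbb P_\mu)=\sup_\mu s(\Omega,\mu),$$ where the suprema are over all Borel probability measures $\mu$ on $\Omega$ and are taken in $[0,\infty]$ (so that all three quantities are $0$ if $\Omega=\emptyset$). -/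

import Mathlib

open MeasureTheory

/-- The symbolic space `Σ_m = {0, …, m-1}^ℕ`, with the product topology (discrete factors) and the
product `σ`-algebra, which is its Borel `σ`-algebra. Sequences are stored with indices starting at `0`:
the term written `x_k` (`k ≥ 1`) in the usual one-based notation is `x (k - 1)`. -/
abbrev SymbSeq (m : ℕ) : Type := ℕ → Fin m

namespace SymbSeq

variable {m : ℕ}

/-- The `k`-th term `x_k` of a sequence `x = (x_1, x_2, …)`, for `k ≥ 1`. -/
def term (x : SymbSeq m) (k : ℕ) : Fin m := x (k - 1)

/-- The number of terms before the first disagreement of `x` and `y`, i.e.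
`min {n ≥ 1 : x_n ≠ y_n} - 1` (only relevant when `x ≠ y`). -/
noncomputable def firstDiff (x y : SymbSeq m) : ℕ :=
  PiNat.firstDiff (E := fun _ => Fin m) x y

open scoped Classical in
/-- The standard metric `ρ(x, y) = m ^ (-min {n ≥ 1 : x_n ≠ y_n} + 1)` for `x ≠ y`. -/
noncomputable def rho (x y : SymbSeq m) : ℝ :=
  if x = y then 0 else ((m : ℝ)⁻¹) ^ firstDiff x y

theorem two_le_of_ne {x y : SymbSeq m} (h : x ≠ y) : 2 ≤ m := by
  by_contra hm
  apply h
  funext n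
  have h1 := (x n).isLt
  have h2 := (y n).isLt
  ext
  omega

theorem rho_lt_pow_iff {x y : SymbSeq m} (hm : 2 ≤ m) (n : ℕ) :
    rho x y < ((m : ℝ)⁻¹) ^ n ↔ ∀ i ≤ n, x i = y i := by
  have h1 : (1 : ℝ) < m := by exact_mod_cast hm
  have h0 : (0 : ℝ) < (m : ℝ)⁻¹ := by positivity
  rcases eq_or_ne x y with rfl | hne
  · simp only [rho, if_true, implies_true, iff_true]
    exact pow_pos h0 n
  · rw [rho, if_neg hne, pow_lt_pow_iff_right_of_lt_one₀ h0 (inv_lt_one_of_one_lt₀ h1)]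
    constructor
    · intro h i hi
      exact PiNat.apply_eq_of_lt_firstDiff (E := fun _ => Fin m) (lt_of_le_of_lt hi h)
    · intro h
      by_contra hc
      exact PiNat.apply_firstDiff_ne (E := fun _ => Fin m) hne (h _ (not_lt.1 hc))

theorem rho_triangle (x y z : SymbSeq m) : rho x z ≤ rho x y + rho y z := by
  have hn : ∀ a b : SymbSeq m, 0 ≤ rho a b := by
    intro a b; unfold rho; split_ifs <;> positivity
  rcases eq_or_ne x z with rfl | hxz
  · have : rho x x = 0 := by simp [rho]
    rw [this]; exact add_nonneg (hn _ _) (hn _ _)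
  rcases eq_or_ne x y with rfl | hxy
  · exact le_add_of_nonneg_left (hn _ _)
  rcases eq_or_ne y z with rfl | hyz
  · exact le_add_of_nonneg_right (hn _ _)
  have hm := two_le_of_ne hxz
  have h1 : (1 : ℝ) < m := by exact_mod_cast hm
  have h0 : (0 : ℝ) < (m : ℝ)⁻¹ := by positivity
  have hle : (m : ℝ)⁻¹ ≤ 1 := (inv_lt_one_of_one_lt₀ h1).le
  rcases min_le_iff.1 (PiNat.min_firstDiff_le (E := fun _ => Fin m) x y z hxz) with h | h
  · refine le_trans ?_ (le_add_of_nonneg_right (hn y z))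
    simp only [rho, if_neg hxz, if_neg hxy]
    exact pow_le_pow_of_le_one h0.le hle h
  · refine le_trans ?_ (le_add_of_nonneg_left (hn x y))
    simp only [rho, if_neg hxz, if_neg hyz]
    exact pow_le_pow_of_le_one h0.le hle h

theorem isOpen_iff_rho (s : Set (SymbSeq m)) :
    IsOpen s ↔ ∀ x ∈ s, ∃ ε > 0, ∀ y, rho x y < ε → y ∈ s := by
  rcases lt_or_ge m 2 with hm | hm
  · have hsub : ∀ x y : SymbSeq m, x = y := fun x y => by
      by_contra h; exact absurd (two_le_of_ne h) (by omega)
    have : Subsingleton (SymbSeq m) := ⟨hsub⟩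
    constructor
    · intro _ x hx
      exact ⟨1, one_pos, fun y _ => hsub x y ▸ hx⟩
    · intro _
      rcases s.eq_empty_or_nonempty with rfl | ⟨x, hx⟩
      · exact isOpen_empty
      · rw [Set.eq_univ_of_forall (s := s) fun y => hsub x y ▸ hx]
        exact isOpen_univ
  have h1 : (1 : ℝ) < m := by exact_mod_cast hm
  have h0 : (0 : ℝ) < (m : ℝ)⁻¹ := by positivity
  constructor
  · intro hs x hx
    obtain ⟨v, ⟨z, n, rfl⟩, hxv, hvs⟩ :=
      (PiNat.isTopologicalBasis_cylinders (fun _ : ℕ => Fin m)).exists_subset_of_mem_open hx hs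
    refine ⟨((m : ℝ)⁻¹) ^ n, pow_pos h0 n, fun y hy => hvs fun i hi => ?_⟩
    rw [← (rho_lt_pow_iff hm n).1 hy i hi.le]
    exact hxv i hi
  · intro h
    refine (PiNat.isTopologicalBasis_cylinders (fun _ : ℕ => Fin m)).isOpen_iff.2 fun x hx => ?_
    obtain ⟨ε, hε, H⟩ := h x hx
    obtain ⟨n, hn⟩ := exists_pow_lt_of_lt_one hε (inv_lt_one_of_one_lt₀ h1)
    refine ⟨PiNat.cylinder (E := fun _ => Fin m) x (n + 1), ⟨x, n + 1, rfl⟩,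
      PiNat.self_mem_cylinder _ _, fun y hy => H y (lt_trans ?_ hn)⟩
    exact (rho_lt_pow_iff hm n).2 fun i hi => (hy i (Nat.lt_succ_of_le hi)).symm

theorem rho_self (x : SymbSeq m) : rho x x = 0 := by simp [rho]

theorem rho_comm (x y : SymbSeq m) : rho x y = rho y x := by
  classical
  unfold rho firstDiff
  simp only [PiNat.firstDiff_comm (E := fun _ => Fin m) x y, eq_comm (a := x) (b := y)]

theorem eq_of_rho_eq_zero (x y : SymbSeq m) (h : rho x y = 0) : x = y := by
  by_contra hne
  have hm := two_le_of_ne hne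
  have h0 : (0 : ℝ) < (m : ℝ)⁻¹ := by positivity
  rw [rho, if_neg hne] at h
  exact (pow_pos h0 _).ne' h

/-- `Σ_m` with the standard metric; the topology is the product topology. -/
noncomputable instance : MetricSpace (SymbSeq m) :=
  letI : Dist (SymbSeq m) := ⟨rho⟩
  MetricSpace.ofDistTopology rho rho_self rho_comm rho_triangle isOpen_iff_rho eq_of_rho_eq_zero

theorem dist_eq_rho (x y : SymbSeq m) : dist x y = rho x y := rfl

end SymbSeq

/-- The cylinder set `[u]` of all sequences starting with the word `u = u_1 … u_n`
(whose letters are stored with indices `0, …, n - 1`). -/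
def wordCylinder {m n : ℕ} (u : Fin n → Fin m) : Set (SymbSeq m) :=
  {x | ∀ j : Fin n, x j = u j}

/-- The multiplicative subshift `X_Ω = X_Ω^{(q)}`: all sequences `(x_k)_{k ≥ 1}` such that
`(x_{i q^ℓ})_{ℓ ≥ 0} ∈ Ω` for every positive integer `i` with `q ∤ i`. -/
def multSubshift {m : ℕ} (q : ℕ) (Ω : Set (SymbSeq m)) : Set (SymbSeq m) :=
  {x | ∀ i : ℕ, 1 ≤ i → ¬ q ∣ i → (fun l => x.term (i * q ^ l) : SymbSeq m) ∈ Ω}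

/-- The Borel probability measures on `Ω`, as Borel probability measures on `Σ_m`
giving full mass to `Ω`. -/
def probMeasuresOn {m : ℕ} (Ω : Set (SymbSeq m)) : Set (ProbabilityMeasure (SymbSeq m)) :=
  {μ | (μ : Measure (SymbSeq m)) Ω = 1}

/-- Place the sequence `y i` along the geometric progression `J_i = {i, q i, q² i, …}`, for every
`i` with `q ∤ i`: the result `x` has `x_n = (y i) r` if `n = q ^ r * i` and `q ∤ i`.
Here `r = padicValNat q n` and `i = n.divMaxPow q`. -/
def placeOnProgressions {m : ℕ} (q : ℕ) (y : ℕ → SymbSeq m) : SymbSeq m :=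
  fun n => y ((n + 1).divMaxPow q) (padicValNat q (n + 1))

/-- The measure `P_μ`: the law of a sequence whose restrictions to the progressions `J_i`, `q ∤ i`,
are independent with law `μ`. It is the Borel measure with
`P_μ [u] = ∏_{i ≤ |u|, q ∤ i} μ [u|J_i]` for every word `u`; see `multMeasure_wordCylinder`. -/
noncomputable def multMeasure {m : ℕ} (q : ℕ) (μ : Measure (SymbSeq m)) : Measure (SymbSeq m) :=
  (Measure.infinitePi fun _ : ℕ => μ).map (placeOnProgressions q)

theorem measurable_placeOnProgressions {m : ℕ} (q : ℕ) :
    Measurable (placeOnProgressions (m := m) q) := by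
  unfold placeOnProgressions
  fun_prop

/-- The defining formula of `P_μ` on cylinders. The set on the right is the cylinder `[u|J_i]` of
the word `u|J_i = u_i u_{q i} … u_{q^r i}`, where `q^r i ≤ |u| < q^(r+1) i`. -/
theorem multMeasure_wordCylinder {m q : ℕ} (hq : 2 ≤ q) (μ : Measure (SymbSeq m))
    [IsProbabilityMeasure μ] {n : ℕ} (u : Fin n → Fin m) :
    multMeasure q μ (wordCylinder u) =
      ∏ i ∈ Finset.Icc 1 n with ¬ q ∣ i,
        μ {z | ∀ r : ℕ, ∀ j : Fin n, (j : ℕ) + 1 = q ^ r * i → z r = u j} := by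
  have hcyl : MeasurableSet (wordCylinder u) := by
    rw [wordCylinder, Set.ofPred_forall]
    exact MeasurableSet.iInter fun j => measurableSet_eq_fun (measurable_pi_apply _) measurable_const
  rw [multMeasure, Measure.map_apply (measurable_placeOnProgressions q) hcyl,
    ← Measure.infinitePi_pi]
  · congr 1
    ext y
    simp only [Set.mem_preimage, wordCylinder, Set.mem_ofPred_eq, Set.mem_pi, Finset.coe_filter,
      Finset.mem_Icc, placeOnProgressions]
    constructor
    · rintro h i ⟨-, hi⟩ r j hj
      have hs := Nat.maxPowDvdDiv_of_pow_mul_eq (Nat.succ_ne_zero (j : ℕ)) hj.symm hi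
      have h1 : padicValNat q ((j : ℕ) + 1) = r := congrArg Prod.fst hs
      have h2 : ((j : ℕ) + 1).divMaxPow q = i := congrArg Prod.snd hs
      have := h j
      rwa [h1, h2] at this
    · intro h j
      have hmul := Nat.pow_padicValNat_mul_divMaxPow q ((j : ℕ) + 1)
      have hnd := Nat.not_dvd_divMaxPow (p := q) (by omega) (Nat.succ_ne_zero (j : ℕ))
      have hdvd : ((j : ℕ) + 1).divMaxPow q ∣ (j : ℕ) + 1 := ⟨_, by rw [mul_comm]; exact hmul.symm⟩
      have hle := Nat.le_of_dvd (Nat.succ_pos _) hdvd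
      have hpos := Nat.pos_of_dvd_of_pos hdvd (Nat.succ_pos _)
      exact h _ ⟨⟨hpos, by omega⟩, hnd⟩ _ j hmul.symm
  · intro i _
    simp only [Set.ofPred_forall]
    exact MeasurableSet.iInter fun r => MeasurableSet.iInter fun j => MeasurableSet.iInter fun _ =>
      measurableSet_eq_fun (measurable_pi_apply _) measurable_const

/-- The Hausdorff dimension of a probability measure:
the infimum of `dim_H F` over Borel sets `F` of full measure. -/
noncomputable def measureDimH {X : Type*} [EMetricSpace X] [MeasurableSpace X]
    (P : Measure X) : ENNReal :=
  ⨅ (F : Set X) (_ : MeasurableSet F) (_ : P F = 1), dimH F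

open scoped Classical in
/-- The entropy `H_m^μ(α_k) = - ∑_{C ∈ α_k} μ(C) log_m μ(C)`, where
`α_k = {Ω ∩ [u] : u a word of length k, Ω ∩ [u] ≠ ∅}`. -/
noncomputable def cylinderEntropy {m : ℕ} (Ω : Set (SymbSeq m)) (μ : Measure (SymbSeq m))
    (k : ℕ) : ℝ :=
  -∑ u : Fin k → Fin m with (Ω ∩ wordCylinder u).Nonempty,
    μ.real (Ω ∩ wordCylinder u) * Real.logb m (μ.real (Ω ∩ wordCylinder u))

/-- The `k`-th term (`k ≥ 1`) of the series that defines `s(Ω, μ)`. -/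
noncomputable def sTerm {m : ℕ} (q : ℕ) (Ω : Set (SymbSeq m)) (μ : Measure (SymbSeq m))
    (k : ℕ) : ℝ :=
  cylinderEntropy Ω μ k / (q : ℝ) ^ (k + 1)

/-- `s(Ω, μ) = (q - 1)² ∑_{k ≥ 1} H_m^μ(α_k) / q^(k+1)`. -/
noncomputable def sDim {m : ℕ} (q : ℕ) (Ω : Set (SymbSeq m)) (μ : Measure (SymbSeq m)) : ℝ :=
  ((q : ℝ) - 1) ^ 2 * ∑' k : ℕ, sTerm q Ω μ (k + 1)

/-! The three quantities are linked by the cycle `s(Ω, μ) ≤ dim P_μ ≤ dim X_Ω ≤ s(Ω, μ*)`, where the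
first two inequalities hold for every `μ` on `Ω` and `μ*` is one explicit measure.

The first inequality (`sDim_le_measureDimH`) is a law of large numbers. Under `P_μ` the restrictions
to the progressions `J_i` are independent with law `μ`, so `-log P_μ[x_1 … x_n]` is a sum of
independent informations. The starting points `i` for which `J_i` meets `{1, …, n}` in exactly `k`
places are those in `(n/q^k, n/q^(k-1)]` with `q ∤ i`; their density is `(q-1)²/q^(k+1)`, which is
the weight in `s(Ω, μ)`. Finitely many `k` already give a lower bound, and the mass distribution
principle `le_dimH_of_measure_cyl_le` turns it into one for the dimension. The second inequality
holds because `P_μ` is carried by `X_Ω`.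

For the third, solve `t u ^ q = ∑ t v` over the children `v` of `u` in the prefix tree of `Ω`
(`exists_bounded_tree_weights`) and let `μ*` move from `u` to `v` with probability `t v / t u ^ q`
(`exists_optimal_measure`). On the whole of `X_Ω`, not just almost everywhere, `log P_μ*[x_1 … x_n]
/ n` at `n = q^(k+1)` equals `-(q-1) log t_∅` plus an increment `A (k+1) - A k` of a nonnegative
sequence. Such increments cannot stay below `-ε`, so `dimH_le_of_le_measure_cyl` gives `dim X_Ω ≤
(q-1) log_m t_∅` (`dimH_multSubshift_le`). Summation by parts shows that this number is `s(Ω, μ*)`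
(`sDim_eq_of_log_measure_cyl`). -/

open Filter Topology
open scoped NNReal ENNReal

/-! ### Cylinders, and dimension bounds from the measures of cylinders. -/

namespace SymbSeq

variable {m : ℕ}

/-- The cylinder of all sequences that agree with `x` in the first `n` places. -/
def cyl (x : SymbSeq m) (n : ℕ) : Set (SymbSeq m) := {y | ∀ i < n, y i = x i}

theorem cyl_eq_wordCylinder (x : SymbSeq m) (n : ℕ) :
    cyl x n = wordCylinder (fun j : Fin n => x j) := by
  ext y
  exact ⟨fun h j => h j j.2, fun h i hi => h ⟨i, hi⟩⟩

theorem measurableSet_wordCylinder {n : ℕ} (u : Fin n → Fin m) :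
    MeasurableSet (wordCylinder u) := by
  rw [wordCylinder, Set.ofPred_forall]
  exact MeasurableSet.iInter fun j =>
    measurableSet_eq_fun (measurable_pi_apply _) measurable_const

theorem measurableSet_cyl (x : SymbSeq m) (n : ℕ) : MeasurableSet (cyl x n) := by
  rw [cyl_eq_wordCylinder]
  exact measurableSet_wordCylinder _

theorem measurable_prefix (n : ℕ) :
    Measurable (fun (x : SymbSeq m) (j : Fin n) => x j) := by
  fun_prop

theorem measurable_measure_cyl (ν : Measure (SymbSeq m)) (n : ℕ) :
    Measurable (fun x : SymbSeq m => ν (cyl x n)) := by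
  simp_rw [cyl_eq_wordCylinder]
  exact (Measurable.of_discrete (f := fun u : Fin n → Fin m => ν (wordCylinder u))).comp
    (measurable_prefix n)

theorem inv_natCast_pow_eq_ofReal (hm : 2 ≤ m) (n : ℕ) :
    ((m : ℝ≥0∞)⁻¹) ^ n = ENNReal.ofReal (((m : ℝ)⁻¹) ^ n) := by
  have : (0 : ℝ) < m := by positivity
  rw [ENNReal.ofReal_pow (by positivity), ENNReal.ofReal_inv_of_pos this, ENNReal.ofReal_natCast]

theorem edist_le_of_agree (hm : 2 ≤ m) {x y : SymbSeq m} {n : ℕ} (h : ∀ i < n, x i = y i) :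
    edist x y ≤ ((m : ℝ≥0∞)⁻¹) ^ n := by
  rw [inv_natCast_pow_eq_ofReal hm, edist_dist]
  apply ENNReal.ofReal_le_ofReal
  rw [dist_eq_rho]
  rcases n with _ | n
  · rw [rho]
    split_ifs
    · simp
    · have : (m : ℝ)⁻¹ ≤ 1 := inv_le_one_of_one_le₀ (by exact_mod_cast (by omega : 1 ≤ m))
      simpa using pow_le_one₀ (by positivity) this
  · by_cases hxy : x = y
    · rw [hxy, rho_self]; positivity
    · rw [rho, if_neg hxy]
      have h1 : (m : ℝ)⁻¹ ≤ 1 := inv_le_one_of_one_le₀ (by exact_mod_cast (by omega : 1 ≤ m))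
      refine pow_le_pow_of_le_one (by positivity) h1 ?_
      by_contra hc
      exact PiNat.apply_firstDiff_ne (E := fun _ => Fin m) hxy (h _ (not_le.1 hc))

theorem le_edist_of_ne (hm : 2 ≤ m) {x y : SymbSeq m} {n : ℕ} (h : x n ≠ y n) :
    ((m : ℝ≥0∞)⁻¹) ^ n ≤ edist x y := by
  rw [inv_natCast_pow_eq_ofReal hm, edist_dist]
  apply ENNReal.ofReal_le_ofReal
  rw [dist_eq_rho]
  by_contra hc
  exact h ((rho_lt_pow_iff hm n).1 (not_le.1 hc) n le_rfl)

theorem ediam_wordCylinder_le (hm : 2 ≤ m) {n : ℕ} (u : Fin n → Fin m) :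
    Metric.ediam (wordCylinder u) ≤ ((m : ℝ≥0∞)⁻¹) ^ n :=
  Metric.ediam_le fun _ hx _ hy => edist_le_of_agree hm fun i hi =>
    (hx ⟨i, hi⟩).trans (hy ⟨i, hi⟩).symm

theorem inv_natCast_lt_one (hm : 2 ≤ m) : (m : ℝ≥0∞)⁻¹ < 1 := by
  rw [ENNReal.inv_lt_one]
  exact_mod_cast (by omega : 1 < m)

theorem tendsto_inv_natCast_pow (hm : 2 ≤ m) :
    Tendsto (fun n : ℕ => ((m : ℝ≥0∞)⁻¹) ^ n) atTop (𝓝 0) :=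
  ENNReal.tendsto_pow_atTop_nhds_zero_of_lt_one (inv_natCast_lt_one hm)

/-- Mass distribution principle: if `ν [x_1 … x_n] ≤ m ^ (- n d)` for all large `n`, for `ν`-almost
every `x`, then every set of full measure has dimension at least `d`. -/
theorem le_dimH_of_measure_cyl_le (hm : 2 ≤ m) (ν : Measure (SymbSeq m)) [IsProbabilityMeasure ν]
    {F : Set (SymbSeq m)} (hF : MeasurableSet F) (hF1 : ν F = 1) (d : ℝ≥0)
    (h : ∀ᵐ x ∂ν, ∀ᶠ n in atTop, ν (cyl x n) ≤ (((m : ℝ≥0∞)⁻¹) ^ n) ^ (d : ℝ)) :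
    (d : ℝ≥0∞) ≤ dimH F := by
  -- The case `d = 0` is split off because the treatment of singletons below needs `m ^ (-n d) → 0`.
  rcases eq_or_ne d 0 with rfl | hd
  · simp
  have hd0 : (0 : ℝ) < d := by positivity
  let A : ℕ → Set (SymbSeq m) := fun N =>
    {x | ∀ n ≥ N, ν (cyl x n) ≤ (((m : ℝ≥0∞)⁻¹) ^ n) ^ (d : ℝ)}
  have hA : ∀ N, MeasurableSet (A N) := by
    intro N
    have : A N = ⋂ n, ⋂ (_ : n ≥ N), {x | ν (cyl x n) ≤ (((m : ℝ≥0∞)⁻¹) ^ n) ^ (d : ℝ)} := by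
      ext x; simp [A]
    rw [this]
    exact MeasurableSet.iInter fun n => MeasurableSet.iInter fun _ =>
      measurableSet_le (measurable_measure_cyl ν n) measurable_const
  obtain ⟨N, hN⟩ : ∃ N, ν (A N) ≠ 0 := by
    by_contra hc
    push Not at hc
    have h0 : ν (⋃ N, A N) = 0 := measure_iUnion_null hc
    have h1 : ∀ᵐ x ∂ν, x ∈ ⋃ N, A N := by
      filter_upwards [h] with x hx
      obtain ⟨N, hN⟩ := eventually_atTop.1 hx
      exact Set.mem_iUnion.2 ⟨N, hN⟩
    have h2 : ν Set.univ = 0 := by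
      exact (measure_congr (eventuallyEq_univ.2 h1)).symm.trans h0
    simp at h2
  refine le_dimH_of_hausdorffMeasure_ne_zero ?_
  -- On `A N` the cylinder bound is uniform from length `N` on, so it suffices to compare with sets
  -- of diameter at most `m ^ (-N)`.
  have key : ν.restrict (A N) ≤ Measure.hausdorffMeasure (d : ℝ) := by
    refine Measure.le_hausdorffMeasure _ _ (((m : ℝ≥0∞)⁻¹) ^ N) ?_ ?_
    · exact ENNReal.pow_pos (ENNReal.inv_pos.2 (ENNReal.natCast_ne_top m)) N
    intro s hs
    rw [Measure.restrict_apply' (hA N)]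
    rcases (s ∩ A N).eq_empty_or_nonempty with he | ⟨x, hxs, hxA⟩
    · simp [he]
    by_cases hsub : s.Subsingleton
    · have h0 : ν (s ∩ A N) = 0 := by
        have hle : ∀ᶠ n in atTop, ν (s ∩ A N) ≤ (((m : ℝ≥0∞)⁻¹) ^ n) ^ (d : ℝ) := by
          filter_upwards [eventually_ge_atTop N] with n hn
          refine (measure_mono ?_).trans (hxA n hn)
          intro y hy i _
          rw [hsub hy.1 hxs]
        have ht : Tendsto (fun n : ℕ => (((m : ℝ≥0∞)⁻¹) ^ n) ^ (d : ℝ)) atTop (𝓝 0) := by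
          have := (ENNReal.continuous_rpow_const (y := (d : ℝ))).tendsto 0 |>.comp
            (tendsto_inv_natCast_pow hm)
          simpa [Function.comp_def, ENNReal.zero_rpow_of_pos hd0] using this
        exact le_antisymm (ge_of_tendsto ht hle) bot_le
      rw [h0]; exact bot_le
    -- At the first index where two points of `s` differ, `s` lies in a cylinder of that length
    -- while its diameter is at least the corresponding power of `m⁻¹`.
    · have hex : ∃ n, ∃ y ∈ s, ∃ z ∈ s, y n ≠ z n := by
        rw [Set.not_subsingleton_iff] at hsub
        obtain ⟨y, hy, z, hz, hyz⟩ := hsub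
        obtain ⟨n, hn⟩ := Function.ne_iff.1 hyz
        exact ⟨n, y, hy, z, hz, hn⟩
      classical
      obtain ⟨y, hy, z, hz, hyz⟩ := Nat.find_spec hex
      have hmin : ∀ i < Nat.find hex, ∀ w ∈ s, w i = x i := by
        intro i hi w hw
        have := Nat.find_min hex hi
        push Not at this
        exact this w hw x hxs
      have hdiam : ((m : ℝ≥0∞)⁻¹) ^ Nat.find hex ≤ Metric.ediam s :=
        (le_edist_of_ne hm hyz).trans (Metric.edist_le_ediam_of_mem hy hz)
      have hge : N ≤ Nat.find hex := by
        by_contra hlt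
        refine absurd (hdiam.trans hs) (not_le.2 ?_)
        rw [inv_natCast_pow_eq_ofReal hm, inv_natCast_pow_eq_ofReal hm,
          ENNReal.ofReal_lt_ofReal_iff (by positivity)]
        exact pow_lt_pow_right_of_lt_one₀ (by positivity)
          (inv_lt_one_of_one_lt₀ (by exact_mod_cast (by omega : 1 < m))) (not_le.1 hlt)
      calc ν (s ∩ A N) ≤ ν (cyl x (Nat.find hex)) :=
            measure_mono fun w hw i hi => hmin i hi w hw.1
        _ ≤ _ := hxA _ hge
        _ ≤ _ := ENNReal.rpow_le_rpow hdiam hd0.le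
  intro h0
  have h1 : ν (F ∩ A N) = 0 := by
    have := key F
    rw [h0, Measure.restrict_apply hF] at this
    exact le_antisymm this bot_le
  apply hN
  rw [← h1]
  have hFae : ∀ᵐ x ∂ν, x ∈ F := by
    rwa [← prob_compl_eq_zero_iff hF] at hF1
  refine measure_congr ?_
  filter_upwards [hFae] with x hx
  exact propext ⟨fun h => ⟨hx, h⟩, fun h => h.2⟩

/-- If every `x ∈ E` satisfies `ν [x_1 … x_n] ≥ m ^ (- n d)` for infinitely many `n`,
then `dim_H E ≤ d`. -/
theorem dimH_le_of_le_measure_cyl (hm : 2 ≤ m) (ν : Measure (SymbSeq m)) [IsProbabilityMeasure ν]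
    {E : Set (SymbSeq m)} (d : ℝ≥0)
    (h : ∀ x ∈ E, ∃ᶠ n in atTop, (((m : ℝ≥0∞)⁻¹) ^ n) ^ (d : ℝ) ≤ ν (cyl x n)) :
    dimH E ≤ d := by
  classical
  refine ENNReal.le_of_forall_pos_le_add fun ε hε _ => ?_
  have hε0 : (0 : ℝ) < ε := by exact_mod_cast hε
  rw [← ENNReal.coe_add]
  refine dimH_le_of_hausdorffMeasure_ne_top ?_
  set c : ℝ≥0∞ := (m : ℝ≥0∞)⁻¹ with hc
  have hc1 : c < 1 := inv_natCast_lt_one hm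
  have hcε : c ^ (ε : ℝ) < 1 := ENNReal.rpow_lt_one hc1 hε0
  -- The cover at stage `N` consists of the heavy cylinders of all lengths `N + n`; light ones are
  -- replaced by `∅`. Words of one length have total mass at most `1`, so the spare exponent `ε`
  -- leaves a geometric series in `n`, bounded uniformly in `N`.
  let t : (N : ℕ) → (Σ n : ℕ, (Fin (N + n) → Fin m)) → Set (SymbSeq m) := fun N p =>
    if (c ^ (N + p.1)) ^ (d : ℝ) ≤ ν (wordCylinder p.2) then wordCylinder p.2 else ∅
  have hb := Measure.hausdorffMeasure_le_liminf_tsum ((d + ε : ℝ≥0) : ℝ) E (l := atTop)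
    (fun N : ℕ => c ^ N) (tendsto_inv_natCast_pow hm) t ?_ ?_
  · refine ne_top_of_le_ne_top ?_ (hb.trans (liminf_le_of_frequently_le' (x := ∑' n : ℕ, (c ^ (ε : ℝ)) ^ n) (Frequently.of_forall fun N => ?_)))
    · rw [ENNReal.tsum_geometric]
      exact ENNReal.inv_ne_top.2 (tsub_pos_of_lt hcε).ne'
    · rw [ENNReal.tsum_sigma']
      refine ENNReal.tsum_le_tsum fun n => ?_
      rw [tsum_fintype]
      calc ∑ u : Fin (N + n) → Fin m, Metric.ediam (t N ⟨n, u⟩) ^ ((d + ε : ℝ≥0) : ℝ)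
          ≤ ∑ u : Fin (N + n) → Fin m, (c ^ (ε : ℝ)) ^ n * ν (wordCylinder u) := by
            refine Finset.sum_le_sum fun u _ => ?_
            simp only [t]
            split_ifs with hu
            · rw [NNReal.coe_add, add_comm (d : ℝ)]
              refine (ENNReal.rpow_le_rpow (ediam_wordCylinder_le hm u) (by positivity)).trans ?_
              rw [ENNReal.rpow_add_of_nonneg _ _ hε0.le d.coe_nonneg]
              refine mul_le_mul' ?_ hu
              rw [← ENNReal.rpow_natCast, ← ENNReal.rpow_mul, mul_comm, ENNReal.rpow_mul,
                ENNReal.rpow_natCast]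
              exact pow_le_pow_right_of_le_one' hcε.le (by omega)
            · have : (0 : ℝ) < ((d + ε : ℝ≥0) : ℝ) := by
                rw [NNReal.coe_add]; exact add_pos_of_nonneg_of_pos d.coe_nonneg hε0
              rw [Metric.ediam_empty, ENNReal.zero_rpow_of_pos this]
              exact bot_le
        _ = (c ^ (ε : ℝ)) ^ n * ∑ u : Fin (N + n) → Fin m, ν (wordCylinder u) := by
            rw [Finset.mul_sum]
        _ ≤ (c ^ (ε : ℝ)) ^ n * 1 := by
            gcongr
            rw [← measure_univ (μ := ν)]
            refine sum_measure_le_measure_univ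
              (fun u _ => (measurableSet_wordCylinder u).nullMeasurableSet) ?_
            intro u _ v _ huv
            refine (Set.disjoint_left.2 fun x hx hy => huv ?_).aedisjoint
            funext j
            rw [← hx j, ← hy j]
        _ = _ := mul_one _
  · refine Eventually.of_forall fun N p => ?_
    simp only [t]
    split_ifs
    · exact (ediam_wordCylinder_le hm p.2).trans (pow_le_pow_right_of_le_one' hc1.le (by omega))
    · simp
  · refine Eventually.of_forall fun N x hx => ?_
    obtain ⟨n, hn, hx⟩ := (frequently_atTop.1 (h x hx)) N
    obtain ⟨k, rfl⟩ := Nat.exists_eq_add_of_le hn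
    refine Set.mem_iUnion.2 ⟨⟨k, fun j => x j⟩, ?_⟩
    simp only [t]
    rw [cyl_eq_wordCylinder] at hx
    rw [if_pos hx]
    exact fun _ => rfl

end SymbSeq

/-! ### The nonlinear equation on the prefix tree. -/

/-- On a tree without leaves and with branching at most `m` there is a bounded solution of
`t u ^ q = ∑ t v`, the sum over the children `v` of `u`. -/
theorem exists_bounded_tree_weights {m q : ℕ} (hq : 2 ≤ q) (T : Set (List (Fin m)))
    (hT : ∀ u ∈ T, ∃ a, u ++ [a] ∈ T) :
    ∃ t : List (Fin m) → ℝ, ∀ u ∈ T, 1 ≤ t u ∧ t u ≤ m ∧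
      t u ^ q = ∑ a, T.indicator t (u ++ [a]) := by
  classical
  -- Fixed-point iteration started at the constant `1`: it increases on `T`, because `T` has no
  -- leaves, and stays below `m`, so it converges pointwise.
  let F : ℕ → List (Fin m) → ℝ := fun N => N.rec (fun _ => 1)
    (fun _ f u => (∑ a, T.indicator f (u ++ [a])) ^ ((q : ℝ)⁻¹))
  have hF0 : ∀ u, F 0 u = 1 := fun _ => rfl
  have hFs : ∀ N u, F (N + 1) u = (∑ a, T.indicator (F N) (u ++ [a])) ^ ((q : ℝ)⁻¹) :=
    fun _ _ => rfl
  have hq0 : q ≠ 0 := by omega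
  have hqpos : (0 : ℝ) ≤ (q : ℝ)⁻¹ := by positivity
  have hmpos : ∀ u ∈ T, (1 : ℝ) ≤ m := by
    intro u hu
    obtain ⟨a, -⟩ := hT u hu
    exact_mod_cast (by have := a.2; omega : 1 ≤ m)
  have hsum1 : ∀ f : List (Fin m) → ℝ, (∀ u ∈ T, 1 ≤ f u) → ∀ u ∈ T,
      1 ≤ ∑ a, T.indicator f (u ++ [a]) := by
    intro f hf u hu
    obtain ⟨a, ha⟩ := hT u hu
    refine le_trans ?_ (Finset.single_le_sum (f := fun a => T.indicator f (u ++ [a]))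
      (fun b _ => Set.indicator_nonneg (fun v hv => zero_le_one.trans (hf v hv)) _)
      (Finset.mem_univ a))
    simpa [Set.indicator_of_mem ha] using hf _ ha
  have hmono_sum : ∀ f g : List (Fin m) → ℝ, (∀ u ∈ T, f u ≤ g u) → ∀ u : List (Fin m),
      ∑ a, T.indicator f (u ++ [a]) ≤ ∑ a, T.indicator g (u ++ [a]) := by
    intro f g hfg u
    exact Finset.sum_le_sum fun a _ => Set.indicator_le_indicator' fun h => hfg _ h
  have hlow : ∀ N, ∀ u ∈ T, 1 ≤ F N u := by
    intro N
    induction N with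
    | zero => exact fun u _ => (hF0 u).ge
    | succ N ih =>
      intro u hu
      rw [hFs]
      exact Real.one_le_rpow (hsum1 _ ih u hu) hqpos
  have hup : ∀ N, ∀ u ∈ T, F N u ≤ m := by
    intro N
    induction N with
    | zero => exact fun u hu => (hF0 u).le.trans (hmpos u hu)
    | succ N ih =>
      intro u hu
      rw [hFs]
      have h1 : ∑ a, T.indicator (F N) (u ++ [a]) ≤ (m : ℝ) ^ q := by
        calc ∑ a, T.indicator (F N) (u ++ [a]) ≤ ∑ _a : Fin m, (m : ℝ) := by
              refine Finset.sum_le_sum fun a _ => ?_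
              by_cases ha : u ++ [a] ∈ T
              · rw [Set.indicator_of_mem ha]; exact ih _ ha
              · rw [Set.indicator_of_notMem ha]; positivity
          _ = (m : ℝ) ^ 2 := by simp [sq]
          -- This is where `q ≥ 2` keeps the bound `m` invariant: at most `m` children, each of
          -- weight at most `m`.
          _ ≤ (m : ℝ) ^ q := pow_le_pow_right₀ (hmpos u hu) hq
      calc _ ≤ ((m : ℝ) ^ q) ^ ((q : ℝ)⁻¹) := Real.rpow_le_rpow
              (zero_le_one.trans (hsum1 _ (hlow N) u hu)) h1 hqpos
        _ = m := Real.pow_rpow_inv_natCast (by positivity) hq0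
  have hmono : ∀ N, ∀ u ∈ T, F N u ≤ F (N + 1) u := by
    intro N
    induction N with
    | zero => exact fun u hu => (hF0 u).le.trans (hlow 1 u hu)
    | succ N ih =>
      intro u hu
      rw [hFs, hFs (N + 1)]
      exact Real.rpow_le_rpow (zero_le_one.trans (hsum1 _ (hlow N) u hu))
        (hmono_sum _ _ ih u) hqpos
  have hlim : ∀ u, ∃ l, u ∈ T → Tendsto (fun N => F N u) atTop (𝓝 l) := by
    intro u
    by_cases hu : u ∈ T
    · refine ⟨_, fun _ => tendsto_atTop_ciSup (monotone_nat_of_le_succ fun N => hmono N u hu) ?_⟩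
      exact ⟨m, by rintro _ ⟨N, rfl⟩; exact hup N u hu⟩
    · exact ⟨0, fun h => absurd h hu⟩
  choose t ht using hlim
  refine ⟨t, fun u hu => ⟨ge_of_tendsto' (ht u hu) fun N => hlow N u hu,
    le_of_tendsto' (ht u hu) fun N => hup N u hu, ?_⟩⟩
  have h1 : Tendsto (fun N => F (N + 1) u ^ q) atTop (𝓝 (t u ^ q)) :=
    (((ht u hu).comp (tendsto_add_atTop_nat 1)).pow q)
  have h2 : Tendsto (fun N => F (N + 1) u ^ q) atTop (𝓝 (∑ a, T.indicator t (u ++ [a]))) := by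
    have : ∀ N, F (N + 1) u ^ q = ∑ a, T.indicator (F N) (u ++ [a]) := by
      intro N
      rw [hFs, Real.rpow_inv_natCast_pow (zero_le_one.trans (hsum1 _ (hlow N) u hu)) hq0]
    simp_rw [this]
    refine tendsto_finsetSum _ fun a _ => ?_
    by_cases ha : u ++ [a] ∈ T
    · simpa only [Set.indicator_of_mem ha] using ht _ ha
    · simp only [Set.indicator_of_notMem ha, tendsto_const_nhds]
  exact tendsto_nhds_unique h1 h2

/-! ### Prefixes, and measures with given transition probabilities. -/

namespace SymbSeq

variable {m : ℕ}

/-- The word formed by the first `k` terms of `x`. -/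
def pre (x : SymbSeq m) (k : ℕ) : List (Fin m) := (List.range k).map x

theorem pre_zero (x : SymbSeq m) : pre x 0 = [] := rfl

theorem pre_succ (x : SymbSeq m) (k : ℕ) : pre x (k + 1) = pre x k ++ [x k] := by
  simp [pre, List.range_succ]

theorem pre_congr {x y : SymbSeq m} {k : ℕ} (h : ∀ i < k, x i = y i) : pre x k = pre y k :=
  List.map_congr_left fun i hi => h i (List.mem_range.1 hi)

theorem pre_eq_iff {x y : SymbSeq m} {k : ℕ} : pre x k = pre y k ↔ ∀ i < k, x i = y i := by
  simp [pre]

theorem length_pre (x : SymbSeq m) (k : ℕ) : (pre x k).length = k := by simp [pre]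

theorem isOpen_cyl (x : SymbSeq m) (n : ℕ) : IsOpen (cyl x n) :=
  PiNat.isOpen_cylinder (E := fun _ => Fin m) x n

theorem self_mem_cyl (x : SymbSeq m) (n : ℕ) : x ∈ cyl x n := fun _ _ => rfl

/-- The word of length `k` read off when, starting from the empty word, `ξ u` is appended to
the current word `u`. -/
def followPre (ξ : List (Fin m) → Fin m) : ℕ → List (Fin m)
  | 0 => []
  | k + 1 => followPre ξ k ++ [ξ (followPre ξ k)]

/-- The sequence read off when, starting from the empty word, `ξ u` is appended to
the current word `u`. -/
def follow (ξ : List (Fin m) → Fin m) : SymbSeq m := fun k => ξ (followPre ξ k)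

theorem pre_follow (ξ : List (Fin m) → Fin m) (k : ℕ) : pre (follow ξ) k = followPre ξ k := by
  induction k with
  | zero => rfl
  | succ k ih => rw [pre_succ, ih]; rfl

/-- There are only countably many words, so one can decompose by the word reached one step earlier,
after which a single coordinate of `ξ` decides. -/
theorem measurableSet_followPre_eq (k : ℕ) (u : List (Fin m)) :
    MeasurableSet {ξ : List (Fin m) → Fin m | followPre ξ k = u} := by
  induction k generalizing u with
  | zero => simp [followPre]
  | succ k ih =>
    have : {ξ : List (Fin m) → Fin m | followPre ξ (k + 1) = u} =
        ⋃ v, ⋃ a, ⋃ (_ : v ++ [a] = u), {ξ | followPre ξ k = v} ∩ {ξ | ξ v = a} := by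
      ext ξ
      simp only [followPre, Set.mem_ofPred_eq, Set.mem_iUnion, Set.mem_inter_iff]
      constructor
      · intro h
        exact ⟨_, _, h, rfl, rfl⟩
      · rintro ⟨v, a, h, rfl, rfl⟩
        exact h
    rw [this]
    exact MeasurableSet.iUnion fun v => MeasurableSet.iUnion fun a => MeasurableSet.iUnion fun _ =>
      (ih v).inter (measurableSet_eq_fun (measurable_pi_apply _) measurable_const)

theorem measurable_follow : Measurable (follow (m := m)) := by
  refine measurable_pi_lambda _ fun k => measurable_to_countable' fun a => ?_
  have : (fun ξ : List (Fin m) → Fin m => follow ξ k) ⁻¹' {a} =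
      ⋃ v, {ξ | followPre ξ k = v} ∩ {ξ | ξ v = a} := by
    ext ξ
    simp [follow]
  rw [this]
  exact MeasurableSet.iUnion fun v => (measurableSet_followPre_eq k v).inter
    (measurableSet_eq_fun (measurable_pi_apply _) measurable_const)

/-- The coordinate of `ξ` consulted at time `j` depends only on the letters before `j`; as long as
these agree with `x`, it is the one indexed by `pre x j`. The event therefore fixes finitely many
coordinates. -/
theorem follow_mem_cyl_iff (ξ : List (Fin m) → Fin m) (x : SymbSeq m) (k : ℕ) :
    follow ξ ∈ cyl x k ↔ ∀ j < k, ξ (pre x j) = x j := by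
  constructor
  · intro h j hj
    have : pre x j = followPre ξ j := by
      rw [← pre_follow]
      exact (pre_congr fun i hi => h i (hi.trans hj)).symm
    rw [this]
    exact h j hj
  · intro h j hj
    induction j using Nat.strong_induction_on with
    | _ j ih =>
      have : pre x j = followPre ξ j := by
        rw [← pre_follow]
        exact (pre_congr fun i hi => ih i hi (hi.trans hj)).symm
      rw [← h j hj, this]
      rfl

/-- There is a measure with prescribed transition probabilities. -/
theorem exists_measure_cyl_eq_prod (p : List (Fin m) → PMF (Fin m)) :
    ∃ μ : ProbabilityMeasure (SymbSeq m), ∀ x k,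
      (μ : Measure (SymbSeq m)) (cyl x k) = ∏ j ∈ Finset.range k, p (pre x j) (x j) := by
  -- One independent letter is drawn for every word; a path visits words of different lengths, so it
  -- never consults a coordinate twice.
  let P : Measure (List (Fin m) → Fin m) := Measure.infinitePi fun u => (p u).toMeasure
  refine ⟨⟨P.map follow, Measure.isProbabilityMeasure_map measurable_follow.aemeasurable⟩, ?_⟩
  intro x k
  have hinj : Set.InjOn (pre x) (Finset.range k) := fun i _ j _ h => by
    simpa [length_pre] using congrArg List.length h
  simp only [ProbabilityMeasure.coe_mk]
  rw [Measure.map_apply measurable_follow (measurableSet_cyl x k)]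
  have hset : follow ⁻¹' cyl x k =
      ((Finset.range k).image (pre x) : Set (List (Fin m))).pi fun u => {x u.length} := by
    ext ξ
    simp only [Set.mem_preimage, follow_mem_cyl_iff, Set.mem_pi, Finset.coe_image,
      Set.forall_mem_image, Finset.coe_range, Set.mem_Iio, Set.mem_singleton_iff, length_pre]
  rw [hset, Measure.infinitePi_pi _ fun _ _ => measurableSet_singleton _,
    Finset.prod_image hinj]
  refine Finset.prod_congr rfl fun j _ => ?_
  rw [length_pre, PMF.toMeasure_apply_singleton _ _ (measurableSet_singleton _)]

/-- The measure on `Ω` that maximizes the dimension, with `L = log t` for a solution `t` of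
`t u ^ q = ∑ t v`, the sum over the children `v` of `u` in the tree of prefixes of `Ω`. -/
theorem exists_optimal_measure {q : ℕ} (hq : 2 ≤ q) {Ω : Set (SymbSeq m)} (hΩ : IsClosed Ω)
    (hne : Ω.Nonempty) :
    ∃ μ ∈ probMeasuresOn Ω, ∃ L : List (Fin m) → ℝ, ∀ x ∈ Ω, ∀ k,
      0 ≤ L (pre x k) ∧ L (pre x k) ≤ Real.log m ∧
      0 < (μ : Measure (SymbSeq m)).real (cyl x k) ∧
      Real.log ((μ : Measure (SymbSeq m)).real (cyl x k)) =
        ∑ j ∈ Finset.range k, (L (pre x (j + 1)) - q * L (pre x j)) := by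
  classical
  let T : Set (List (Fin m)) := {u | ∃ y ∈ Ω, ∃ k, pre y k = u}
  have hTmem : ∀ x ∈ Ω, ∀ k, pre x k ∈ T := fun x hx k => ⟨x, hx, k, rfl⟩
  have hT : ∀ u ∈ T, ∃ a, u ++ [a] ∈ T := by
    rintro _ ⟨y, hy, k, rfl⟩
    exact ⟨y k, y, hy, k + 1, pre_succ y k⟩
  obtain ⟨t, ht⟩ := exists_bounded_tree_weights hq T hT
  have htpos : ∀ u ∈ T, 0 < t u := fun u hu => zero_lt_one.trans_le (ht u hu).1
  obtain ⟨x₀, hx₀⟩ := hne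
  have hp : ∀ u : List (Fin m), ∃ p : PMF (Fin m), u ∈ T → ∀ a,
      p a = ENNReal.ofReal (T.indicator t (u ++ [a]) / t u ^ q) := by
    intro u
    by_cases hu : u ∈ T
    · refine ⟨PMF.ofFintype (fun a => ENNReal.ofReal (T.indicator t (u ++ [a]) / t u ^ q)) ?_,
        fun _ a => rfl⟩
      have h0 := htpos u hu
      rw [← ENNReal.ofReal_sum_of_nonneg, ← Finset.sum_div, ← (ht u hu).2.2, div_self (by positivity),
        ENNReal.ofReal_one]
      exact fun a _ => div_nonneg (Set.indicator_nonneg (fun v hv => (htpos v hv).le) _)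
        (by positivity)
    -- Off the tree the transition is irrelevant; any point mass will do.
    · exact ⟨PMF.pure (x₀ 0), fun h => absurd h hu⟩
  choose p hp using hp
  obtain ⟨μ, hμ⟩ := exists_measure_cyl_eq_prod p
  refine ⟨μ, ?_, fun u => Real.log (t u), ?_⟩
  · have h0 : (μ : Measure (SymbSeq m)) Ωᶜ = 0 := by
      refine measure_null_of_locally_null _ fun x hx => ?_
      -- As `Ω` is closed, a point outside it has a prefix outside `T`. At the first such prefix the
      -- last transition has probability `0`, so that cylinder is null.
      have hex : ∃ n, pre x n ∉ T := by
        obtain ⟨v, ⟨z, n, rfl⟩, hxv, hvs⟩ :=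
          (PiNat.isTopologicalBasis_cylinders (fun _ : ℕ => Fin m)).exists_subset_of_mem_open hx
            hΩ.isOpen_compl
        refine ⟨n, ?_⟩
        rintro ⟨y, hy, k, hk⟩
        have hkn : k = n := by simpa [length_pre] using congrArg List.length hk
        subst hkn
        rw [pre_eq_iff] at hk
        exact hvs (fun i hi => (hk i hi).trans (hxv i hi)) hy
      refine ⟨cyl x (Nat.find hex), mem_nhdsWithin_of_mem_nhds
        ((isOpen_cyl x _).mem_nhds (self_mem_cyl x _)), ?_⟩
      have hn := Nat.find_spec hex
      have hmin := fun k => Nat.find_min hex (m := k)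
      rw [hμ]
      generalize Nat.find hex = n at *
      rcases n with _ | n
      · exact absurd (hTmem x₀ hx₀ 0) hn
      · refine Finset.prod_eq_zero (Finset.mem_range.2 (Nat.lt_succ_self n)) ?_
        rw [hp _ (not_not.1 (hmin n (Nat.lt_succ_self n))), ← pre_succ,
          Set.indicator_of_notMem hn]
        simp
    exact (prob_compl_eq_zero_iff hΩ.measurableSet).1 h0
  · intro x hx k
    have hreal : (μ : Measure (SymbSeq m)).real (cyl x k) =
        ∏ j ∈ Finset.range k, t (pre x (j + 1)) / t (pre x j) ^ q := by
      rw [measureReal_def, hμ, ENNReal.toReal_prod]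
      refine Finset.prod_congr rfl fun j _ => ?_
      have h1 := htpos _ (hTmem x hx (j + 1))
      have h2 := htpos _ (hTmem x hx j)
      rw [hp _ (hTmem x hx j), ← pre_succ, Set.indicator_of_mem (hTmem x hx (j + 1)),
        ENNReal.toReal_ofReal (by positivity)]
    have hk := ht _ (hTmem x hx k)
    refine ⟨Real.log_nonneg hk.1, Real.log_le_log (htpos _ (hTmem x hx k)) hk.2.1, ?_, ?_⟩
    · rw [hreal]
      refine Finset.prod_pos fun j _ => ?_
      have h1 := htpos _ (hTmem x hx (j + 1))
      have h2 := htpos _ (hTmem x hx j)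
      positivity
    · rw [hreal, Real.log_prod]
      · refine Finset.sum_congr rfl fun j _ => ?_
        have h1 := htpos _ (hTmem x hx (j + 1))
        have h2 := htpos _ (hTmem x hx j)
        rw [Real.log_div (by positivity) (by positivity), Real.log_pow]
      · intro j _
        have h1 := htpos _ (hTmem x hx (j + 1))
        have h2 := htpos _ (hTmem x hx j)
        positivity

end SymbSeq

/-! ### Counting along the progressions. -/

/-- The integers `1 ≤ i ≤ n` not divisible by `q`: the starting points of the progressions
`J_i = {i, q i, q² i, …}` that meet `{1, …, n}`. -/
def progStarts (q n : ℕ) : Finset ℕ := {i ∈ Finset.Icc 1 n | ¬ q ∣ i}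

/-- The number of elements of `J_i = {i, q i, q² i, …}` in `{1, …, n}`, for `1 ≤ i ≤ n`. -/
def progLength (q n i : ℕ) : ℕ := Nat.log q (n / i) + 1

theorem mem_progStarts {q n i : ℕ} : i ∈ progStarts q n ↔ (1 ≤ i ∧ i ≤ n) ∧ ¬ q ∣ i := by
  simp [progStarts]

theorem lt_progLength_iff {q n i : ℕ} (hq : 2 ≤ q) (h1 : 1 ≤ i) (hn : i ≤ n) (j : ℕ) :
    j < progLength q n i ↔ q ^ j * i ≤ n := by
  rw [progLength, Nat.lt_succ_iff, Nat.le_log_iff_pow_le (by omega)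
    (Nat.div_pos hn (by omega)).ne', Nat.le_div_iff_mul_le (by omega)]

theorem padicValNat_pow_mul_of_not_dvd {q i : ℕ} (hq : 2 ≤ q) (hi : ¬ q ∣ i) (j : ℕ) :
    padicValNat q (q ^ j * i) = j :=
  have h0 : i ≠ 0 := fun h => hi (h ▸ dvd_zero q)
  congrArg Prod.fst (Nat.maxPowDvdDiv_of_pow_mul_eq
    (mul_ne_zero (pow_ne_zero j (by omega)) h0) rfl hi)

theorem divMaxPow_pow_mul_of_not_dvd {q i : ℕ} (hq : 2 ≤ q) (hi : ¬ q ∣ i) (j : ℕ) :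
    (q ^ j * i).divMaxPow q = i :=
  have h0 : i ≠ 0 := fun h => hi (h ▸ dvd_zero q)
  congrArg Prod.snd (Nat.maxPowDvdDiv_of_pow_mul_eq
    (mul_ne_zero (pow_ne_zero j (by omega)) h0) rfl hi)

/-- Every `a ≥ 1` is uniquely `q ^ j * i` with `q ∤ i`, so the progressions partition `{1, …, n}`.
-/
theorem sum_progressions {q : ℕ} (hq : 2 ≤ q) (n : ℕ) (G : ℕ → ℝ) :
    ∑ i ∈ progStarts q n, ∑ j ∈ Finset.range (progLength q n i), G (q ^ j * i) =
      ∑ a ∈ Finset.Icc 1 n, G a := by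
  rw [Finset.sum_sigma']
  refine Finset.sum_bij' (fun p _ => q ^ p.2 * p.1)
    (fun a _ => ⟨a.divMaxPow q, padicValNat q a⟩) ?_ ?_ ?_ ?_ ?_
  · rintro ⟨i, j⟩ h
    rw [Finset.mem_sigma, mem_progStarts, Finset.mem_range] at h
    obtain ⟨⟨⟨h1, hn⟩, hi⟩, hj⟩ := h
    rw [lt_progLength_iff hq h1 hn] at hj
    exact Finset.mem_Icc.2 ⟨Nat.mul_pos (Nat.pow_pos (by omega)) h1, hj⟩
  · intro a ha
    rw [Finset.mem_Icc] at ha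
    have hmul := Nat.pow_padicValNat_mul_divMaxPow q a
    have hnd := Nat.not_dvd_divMaxPow (p := q) (by omega) (show a ≠ 0 by omega)
    have hdvd : a.divMaxPow q ∣ a := ⟨_, by rw [mul_comm]; exact hmul.symm⟩
    have hle := Nat.le_of_dvd (by omega) hdvd
    have hpos := Nat.pos_of_dvd_of_pos hdvd (by omega)
    rw [Finset.mem_sigma, mem_progStarts, Finset.mem_range]
    refine ⟨⟨⟨hpos, hle.trans ha.2⟩, hnd⟩, ?_⟩
    simp only
    rw [lt_progLength_iff hq hpos (hle.trans ha.2), hmul]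
    exact ha.2
  · rintro ⟨i, j⟩ h
    rw [Finset.mem_sigma, mem_progStarts] at h
    simp only [padicValNat_pow_mul_of_not_dvd hq h.1.2, divMaxPow_pow_mul_of_not_dvd hq h.1.2]
  · intro a _
    exact Nat.pow_padicValNat_mul_divMaxPow q a
  · intro _ _
    rfl

theorem sum_Icc_mul_eq {q : ℕ} (hq : 2 ≤ q) (M : ℕ) (h : ℕ → ℝ) :
    ∑ a ∈ Finset.Icc 1 (q * M), h a =
      ∑ a ∈ Finset.Icc 1 (q * M) with ¬ q ∣ a, h a + ∑ b ∈ Finset.Icc 1 M, h (q * b) := by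
  rw [← Finset.sum_filter_not_add_sum_filter (Finset.Icc 1 (q * M)) (fun a => q ∣ a)]
  congr 1
  symm
  refine Finset.sum_bij (fun b _ => q * b) ?_ ?_ ?_ ?_
  · intro b hb
    rw [Finset.mem_Icc] at hb
    rw [Finset.mem_filter, Finset.mem_Icc]
    exact ⟨⟨Nat.mul_pos (by omega) hb.1, Nat.mul_le_mul_left q hb.2⟩, dvd_mul_right q b⟩
  · intro b _ c _ hbc
    exact Nat.eq_of_mul_eq_mul_left (by omega) hbc
  · intro a ha
    rw [Finset.mem_filter, Finset.mem_Icc] at ha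
    obtain ⟨⟨h1, h2⟩, b, rfl⟩ := ha
    refine ⟨b, Finset.mem_Icc.2 ⟨?_, Nat.le_of_mul_le_mul_left h2 (by omega)⟩, rfl⟩
    exact Nat.pos_of_ne_zero (by rintro rfl; simp at h1)
  · intro _ _
    rfl

theorem card_not_dvd {q : ℕ} (hq : 2 ≤ q) (M : ℕ) :
    ((Finset.card {a ∈ Finset.Icc 1 (q * M) | ¬ q ∣ a} : ℕ) : ℝ) = q * M - M := by
  have := sum_Icc_mul_eq hq M (fun _ => 1)
  simp only [Finset.sum_const, Nat.card_Icc, nsmul_eq_mul, mul_one, Nat.add_sub_cancel] at this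
  push_cast at this
  linarith

/-- A sequence that is bounded below has infinitely many increments `≥ -ε`. -/
theorem frequently_neg_le_sub_of_nonneg {A : ℕ → ℝ} (hA : ∀ k, 0 ≤ A k) {ε : ℝ} (hε : 0 < ε) :
    ∃ᶠ k in atTop, -ε ≤ A (k + 1) - A k := by
  intro hc
  obtain ⟨N, hN⟩ := eventually_atTop.1 hc
  have h : ∀ j : ℕ, A (N + j) ≤ A N - j * ε := by
    intro j
    induction j with
    | zero => simp
    | succ j ih =>
      have := hN (N + j) (by omega)
      push_cast
      rw [← add_assoc]
      linarith
  obtain ⟨j, hj⟩ := exists_nat_gt (A N / ε)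
  rw [div_lt_iff₀ hε] at hj
  linarith [h j, hA (N + j)]

/-! ### The upper bound for the dimension of the subshift. -/

namespace SymbSeq

variable {m : ℕ}

/-- The restriction `(x_{i q^l})_{l ≥ 0}` of `x` to the progression `J_i = {i, q i, q² i, …}`. -/
def along (q : ℕ) (x : SymbSeq m) (i : ℕ) : SymbSeq m := fun l => x.term (i * q ^ l)

theorem multMeasure_cyl {q : ℕ} (hq : 2 ≤ q) (μ : Measure (SymbSeq m)) [IsProbabilityMeasure μ]
    (x : SymbSeq m) (n : ℕ) :
    multMeasure q μ (cyl x n) =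
      ∏ i ∈ progStarts q n, μ (cyl (along q x i) (progLength q n i)) := by
  rw [cyl_eq_wordCylinder, multMeasure_wordCylinder hq]
  refine Finset.prod_congr rfl fun i hi => ?_
  obtain ⟨⟨h1, hn⟩, -⟩ := mem_progStarts.1 hi
  congr 1
  ext z
  simp only [cyl, along, term, Set.mem_ofPred_eq, lt_progLength_iff hq h1 hn]
  constructor
  · intro h r hr
    have hpos : 0 < q ^ r * i := Nat.mul_pos (Nat.pow_pos (by omega)) h1
    have := h r ⟨q ^ r * i - 1, by omega⟩ (by simp only; omega)
    rw [this, mul_comm i]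
  · intro h r j hj
    rw [h r (by omega), mul_comm i, ← hj, Nat.add_sub_cancel]

instance (q : ℕ) (μ : Measure (SymbSeq m)) [IsProbabilityMeasure μ] :
    IsProbabilityMeasure (multMeasure q μ) :=
  Measure.isProbabilityMeasure_map (measurable_placeOnProgressions q).aemeasurable

theorem log_multMeasure_cyl {q : ℕ} (hq : 2 ≤ q) (μ : Measure (SymbSeq m))
    [IsProbabilityMeasure μ] (x : SymbSeq m) (n : ℕ)
    (hpos : ∀ i ∈ progStarts q n, 0 < μ.real (cyl (along q x i) (progLength q n i))) :
    0 < (multMeasure q μ).real (cyl x n) ∧ Real.log ((multMeasure q μ).real (cyl x n)) =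
      ∑ i ∈ progStarts q n, Real.log (μ.real (cyl (along q x i) (progLength q n i))) := by
  have h : (multMeasure q μ).real (cyl x n) =
      ∏ i ∈ progStarts q n, μ.real (cyl (along q x i) (progLength q n i)) := by
    rw [measureReal_def, multMeasure_cyl hq, ENNReal.toReal_prod]
    rfl
  rw [h]
  exact ⟨Finset.prod_pos hpos, Real.log_prod fun i hi => (hpos i hi).ne'⟩

theorem pow_rpow_eq_ofReal_exp (hm : 2 ≤ m) (n : ℕ) (d : ℝ≥0) :
    (((m : ℝ≥0∞)⁻¹) ^ n) ^ (d : ℝ) = ENNReal.ofReal (Real.exp (-(n * d * Real.log m))) := by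
  have hm0 : (0 : ℝ) < m := by positivity
  rw [inv_natCast_pow_eq_ofReal hm, ENNReal.ofReal_rpow_of_nonneg (by positivity) d.coe_nonneg,
    Real.rpow_def_of_pos (by positivity), Real.log_pow, Real.log_inv]
  congr 2
  ring

theorem pow_rpow_le_iff (hm : 2 ≤ m) (n : ℕ) (d : ℝ≥0) (ν : Measure (SymbSeq m))
    [IsProbabilityMeasure ν] (x : SymbSeq m) (hpos : 0 < ν.real (cyl x n)) :
    (((m : ℝ≥0∞)⁻¹) ^ n) ^ (d : ℝ) ≤ ν (cyl x n) ↔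
      -(n * d * Real.log m) ≤ Real.log (ν.real (cyl x n)) := by
  rw [pow_rpow_eq_ofReal_exp hm, ← ofReal_measureReal, ENNReal.ofReal_le_ofReal_iff hpos.le,
    Real.le_log_iff_exp_le hpos]

theorem le_pow_rpow_iff (hm : 2 ≤ m) (n : ℕ) (d : ℝ≥0) (ν : Measure (SymbSeq m))
    [IsProbabilityMeasure ν] (x : SymbSeq m) (hpos : 0 < ν.real (cyl x n)) :
    ν (cyl x n) ≤ (((m : ℝ≥0∞)⁻¹) ^ n) ^ (d : ℝ) ↔
      Real.log (ν.real (cyl x n)) ≤ -(n * d * Real.log m) := by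
  rw [pow_rpow_eq_ofReal_exp hm, ← ofReal_measureReal,
    ENNReal.ofReal_le_ofReal_iff (Real.exp_pos _).le, Real.log_le_iff_le_exp hpos]

/-- Upper bound for the dimension of a multiplicative subshift from a measure whose cylinder
weights have the form provided by `exists_optimal_measure`. -/
theorem dimH_multSubshift_le (hm : 2 ≤ m) {q : ℕ} (hq : 2 ≤ q) {Ω : Set (SymbSeq m)}
    (μ : Measure (SymbSeq m)) [IsProbabilityMeasure μ] (L : List (Fin m) → ℝ)
    (hL : ∀ x ∈ Ω, ∀ k, 0 ≤ L (pre x k) ∧ L (pre x k) ≤ Real.log m ∧ 0 < μ.real (cyl x k) ∧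
      Real.log (μ.real (cyl x k)) =
        ∑ j ∈ Finset.range k, (L (pre x (j + 1)) - q * L (pre x j))) :
    dimH (multSubshift q Ω) ≤ ENNReal.ofReal ((q - 1) * L [] / Real.log m) := by
  have hlogm : 0 < Real.log m := Real.log_pos (by exact_mod_cast (by omega : 1 < m))
  have hq2 : (2 : ℝ) ≤ q := by exact_mod_cast hq
  rcases (multSubshift q Ω).eq_empty_or_nonempty with he | ⟨x₀, hx₀⟩
  · rw [he, dimH_empty]; exact bot_le
  -- The progression `i = 1` of a point of the subshift supplies the point of `Ω` needed here.
  have hL0 : 0 ≤ L [] := (hL _ (hx₀ 1 le_rfl (by rw [Nat.dvd_one]; omega)) 0).1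
  refine ENNReal.le_of_forall_pos_le_add fun ε hε _ => ?_
  have hε0 : (0 : ℝ) < ε := by exact_mod_cast hε
  rw [ENNReal.ofReal, ← ENNReal.coe_add]
  refine dimH_le_of_le_measure_cyl hm (multMeasure q μ) _ fun x hx => ?_
  have hy : ∀ i, 1 ≤ i → ¬ q ∣ i → along q x i ∈ Ω := hx
  -- Both read the progression through `a` up to position `a`: `τ` includes that position, `τ'`
  -- stops just before it. Hence `τ' (q * b) = τ b`, and `τ'` takes the root value when `q ∤ a`.
  set τ : ℕ → ℝ := fun a => L (pre (along q x (a.divMaxPow q)) (padicValNat q a + 1)) with hτ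
  set τ' : ℕ → ℝ := fun a => L (pre (along q x (a.divMaxPow q)) (padicValNat q a)) with hτ'
  have hlog : ∀ n, 0 < (multMeasure q μ).real (cyl x n) ∧
      Real.log ((multMeasure q μ).real (cyl x n)) =
        ∑ a ∈ Finset.Icc 1 n, (τ a - q * τ' a) := by
    intro n
    obtain ⟨h1, h2⟩ := log_multMeasure_cyl hq μ x n fun i hi => by
      obtain ⟨⟨h1, -⟩, h2⟩ := mem_progStarts.1 hi
      exact (hL _ (hy i h1 h2) _).2.2.1
    refine ⟨h1, ?_⟩
    rw [h2, ← sum_progressions hq]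
    refine Finset.sum_congr rfl fun i hi => ?_
    obtain ⟨⟨h1, -⟩, h2⟩ := mem_progStarts.1 hi
    rw [(hL _ (hy i h1 h2) _).2.2.2]
    refine Finset.sum_congr rfl fun j _ => ?_
    simp only [hτ, hτ', padicValNat_pow_mul_of_not_dvd hq h2, divMaxPow_pow_mul_of_not_dvd hq h2]
  have hτ'mul : ∀ b ≥ 1, τ' (q * b) = τ b := by
    intro b hb
    simp only [hτ, hτ']
    rw [padicValNat_base_mul (by omega) (by omega), Nat.divMaxPow_base_mul (by omega)]
  have hτ'nd : ∀ a, ¬ q ∣ a → τ' a = L [] := by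
    intro a ha
    have := padicValNat_pow_mul_of_not_dvd hq ha 0
    rw [pow_zero, one_mul] at this
    simp only [hτ', this, pre_zero]
  have hτpos : ∀ a ≥ 1, 0 ≤ τ a := by
    intro a ha
    have hdvd : a.divMaxPow q ∣ a :=
      ⟨_, by rw [mul_comm]; exact (Nat.pow_padicValNat_mul_divMaxPow q a).symm⟩
    exact (hL _ (hy _ (Nat.pos_of_dvd_of_pos hdvd ha)
      (Nat.not_dvd_divMaxPow (by omega) (by omega))) _).1
  have hS : ∀ M, Real.log ((multMeasure q μ).real (cyl x (q * M))) =
      ∑ a ∈ Finset.Icc 1 (q * M), τ a - q * ∑ a ∈ Finset.Icc 1 M, τ a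
        - q * ((q * M - M) * L []) := by
    intro M
    rw [(hlog _).2, Finset.sum_sub_distrib, ← Finset.mul_sum, sum_Icc_mul_eq hq M τ',
      Finset.sum_congr rfl fun b hb => hτ'mul b (Finset.mem_Icc.1 hb).1,
      Finset.sum_congr rfl fun a ha => hτ'nd a (Finset.mem_filter.1 ha).2, Finset.sum_const,
      nsmul_eq_mul, card_not_dvd hq]
    ring
  -- By `hS`, at `n = q ^ (k + 1)` the logarithm divided by `n` is `A (k + 1) - A k - (q - 1) * L
  -- []`.
  let A : ℕ → ℝ := fun k => (∑ a ∈ Finset.Icc 1 (q ^ k), τ a) / q ^ k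
  have hfreq := frequently_neg_le_sub_of_nonneg (A := A)
    (fun k => div_nonneg (Finset.sum_nonneg fun a ha => hτpos a (Finset.mem_Icc.1 ha).1)
      (by positivity)) (mul_pos hε0 hlogm)
  rw [frequently_atTop] at hfreq ⊢
  intro N
  obtain ⟨k, hk, hA⟩ := hfreq N
  have hkq : k < q ^ (k + 1) := (Nat.lt_succ_self k).trans (Nat.lt_pow_self (by omega))
  refine ⟨q ^ (k + 1), by omega, ?_⟩
  rw [pow_rpow_le_iff hm _ _ _ _ (hlog _).1, pow_succ', hS]
  have hQ : (0 : ℝ) < (q : ℝ) ^ k := by positivity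
  have e1 : ∑ a ∈ Finset.Icc 1 (q * q ^ k), τ a = q * q ^ k * A (k + 1) := by
    simp only [A, pow_succ']
    field_simp
  have e2 : ∑ a ∈ Finset.Icc 1 (q ^ k), τ a = q ^ k * A k := by
    simp only [A]
    field_simp
  rw [e1, e2]
  push_cast
  rw [Real.coe_toNNReal _ (div_nonneg (mul_nonneg (by linarith) hL0) hlogm.le)]
  have e3 : (q : ℝ) * q ^ k * ((q - 1) * L [] / Real.log m + ε) * Real.log m =
      q * q ^ k * ((q - 1) * L []) + q * q ^ k * (ε * Real.log m) := by
    field_simp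
  rw [e3]
  have hqq : (0 : ℝ) ≤ q * q ^ k := by positivity
  nlinarith [mul_le_mul_of_nonneg_left hA hqq]

end SymbSeq

/-! ### Entropy, and the value of `s` at the optimal measure. -/

/-- The entropy of a probability vector is at most the logarithm of its length. -/
theorem neg_sum_mul_log_le_log_card {ι : Type*} [Fintype ι] [Nonempty ι] (p : ι → ℝ)
    (hp : ∀ i, 0 ≤ p i) (hp1 : ∑ i, p i = 1) :
    -∑ i, p i * Real.log (p i) ≤ Real.log (Fintype.card ι) := by
  have hN : (0 : ℝ) < Fintype.card ι := by exact_mod_cast Fintype.card_pos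
  have h : ∀ i, -(p i * Real.log (p i)) - p i * Real.log (Fintype.card ι) ≤
      (Fintype.card ι : ℝ)⁻¹ - p i := by
    intro i
    rcases (hp i).eq_or_lt with h0 | h0
    · rw [← h0]; simp
    -- The inequality `log y ≤ y - 1` at `y = 1 / (p i * N)`, multiplied by `p i`, gives Gibbs'
    -- inequality against the uniform vector.
    · have h1 := Real.log_le_sub_one_of_pos (x := (p i * Fintype.card ι)⁻¹) (by positivity)
      rw [Real.log_inv, Real.log_mul h0.ne' hN.ne'] at h1
      have h2 := mul_le_mul_of_nonneg_left h1 h0.le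
      have h3 : p i * ((p i * Fintype.card ι)⁻¹ - 1) = (Fintype.card ι : ℝ)⁻¹ - p i := by
        field_simp
      linarith
  have hs := Finset.sum_le_sum fun i (_ : i ∈ Finset.univ) => h i
  rw [Finset.sum_sub_distrib, Finset.sum_sub_distrib, ← Finset.sum_mul, hp1,
    Finset.sum_neg_distrib] at hs
  simp only [Finset.sum_const, Finset.card_univ, nsmul_eq_mul] at hs
  rw [mul_inv_cancel₀ hN.ne'] at hs
  linarith

namespace SymbSeq

variable {m : ℕ}

theorem integrable_comp_prefix (μ : Measure (SymbSeq m)) [IsProbabilityMeasure μ] (k : ℕ)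
    (g : (Fin k → Fin m) → ℝ) : Integrable (fun x : SymbSeq m => g fun j => x j) μ := by
  have : Integrable g (μ.map fun (x : SymbSeq m) (j : Fin k) => x j) := by
    have := Measure.isProbabilityMeasure_map (μ := μ) (measurable_prefix (m := m) k).aemeasurable
    exact Integrable.of_finite
  exact this.comp_measurable (measurable_prefix k)

theorem integral_comp_prefix (μ : Measure (SymbSeq m)) [IsProbabilityMeasure μ] (k : ℕ)
    (g : (Fin k → Fin m) → ℝ) :
    ∫ x, g (fun j => x j) ∂μ = ∑ u, μ.real (wordCylinder u) * g u := by
  have hp := Measure.isProbabilityMeasure_map (μ := μ) (measurable_prefix (m := m) k).aemeasurable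
  rw [← integral_map (f := g) (measurable_prefix k).aemeasurable
    (Measurable.of_discrete.aestronglyMeasurable), integral_fintype Integrable.of_finite]
  refine Finset.sum_congr rfl fun u _ => ?_
  rw [map_measureReal_apply (measurable_prefix k) (measurableSet_singleton u), smul_eq_mul]
  congr 2
  ext x
  simp [wordCylinder, funext_iff]

theorem sum_measureReal_wordCylinder (μ : Measure (SymbSeq m)) [IsProbabilityMeasure μ] (k : ℕ) :
    ∑ u : Fin k → Fin m, μ.real (wordCylinder u) = 1 := by
  simpa using (integral_comp_prefix μ k fun _ => 1).symm

/-- The information function `x ↦ -log μ [x_1 … x_k]`. -/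
noncomputable def info (μ : Measure (SymbSeq m)) (k : ℕ) (x : SymbSeq m) : ℝ :=
  -Real.log (μ.real (cyl x k))

theorem info_eq (μ : Measure (SymbSeq m)) (k : ℕ) :
    info μ k = fun x : SymbSeq m =>
      (fun u : Fin k → Fin m => -Real.log (μ.real (wordCylinder u))) (fun j => x j) := by
  funext x
  rw [info, cyl_eq_wordCylinder]

theorem integrable_info (μ : Measure (SymbSeq m)) [IsProbabilityMeasure μ] (k : ℕ) :
    Integrable (info μ k) μ := by
  rw [info_eq]
  exact integrable_comp_prefix μ k fun u => -Real.log (μ.real (wordCylinder u))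

theorem measurable_info (μ : Measure (SymbSeq m)) (k : ℕ) : Measurable (info μ k) := by
  rw [info_eq]
  exact (Measurable.of_discrete (f := fun u : Fin k → Fin m =>
    -Real.log (μ.real (wordCylinder u)))).comp (measurable_prefix k)

theorem info_nonneg (μ : Measure (SymbSeq m)) [IsProbabilityMeasure μ] (k : ℕ) (x : SymbSeq m) :
    0 ≤ info μ k x :=
  neg_nonneg.2 (Real.log_nonpos measureReal_nonneg measureReal_le_one)

theorem integral_info (μ : Measure (SymbSeq m)) [IsProbabilityMeasure μ] (k : ℕ) :
    ∫ x, info μ k x ∂μ =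
      -∑ u : Fin k → Fin m, μ.real (wordCylinder u) * Real.log (μ.real (wordCylinder u)) := by
  rw [info_eq]
  refine (integral_comp_prefix μ k _).trans ?_
  simp

theorem integral_info_le (μ : Measure (SymbSeq m)) [IsProbabilityMeasure μ] (k : ℕ) :
    ∫ x, info μ k x ∂μ ≤ k * Real.log m := by
  rw [integral_info]
  have : Nonempty (SymbSeq m) := nonempty_of_isProbabilityMeasure μ
  have : Nonempty (Fin k → Fin m) := this.map fun x j => x j
  refine (neg_sum_mul_log_le_log_card (fun u : Fin k → Fin m => μ.real (wordCylinder u))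
    (fun _ => measureReal_nonneg) (sum_measureReal_wordCylinder μ k)).trans ?_
  simp

theorem ae_mem_of_measure_eq_one {μ : Measure (SymbSeq m)} [IsProbabilityMeasure μ]
    {Ω : Set (SymbSeq m)} (hΩ : MeasurableSet Ω) (h : μ Ω = 1) : ∀ᵐ x ∂μ, x ∈ Ω :=
  (prob_compl_eq_zero_iff hΩ).2 h

/-- Full mass on `Ω` makes the intersections with `Ω` harmless, and the cells left out of the
partition are empty, hence contribute `0`. -/
theorem cylinderEntropy_eq {Ω : Set (SymbSeq m)} (hΩ : MeasurableSet Ω) (μ : Measure (SymbSeq m))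
    [IsProbabilityMeasure μ] (h : μ Ω = 1) (k : ℕ) :
    cylinderEntropy Ω μ k = (∫ x, info μ k x ∂μ) / Real.log m := by
  classical
  have hcyl : ∀ u : Fin k → Fin m, μ.real (Ω ∩ wordCylinder u) = μ.real (wordCylinder u) := by
    intro u
    refine measureReal_congr ?_
    filter_upwards [ae_mem_of_measure_eq_one hΩ h] with x hx
    exact propext ⟨fun h => h.2, fun h => ⟨hx, h⟩⟩
  rw [cylinderEntropy, integral_info, neg_div, Finset.sum_div]
  congr 1
  rw [Finset.sum_filter_of_ne]
  · refine Finset.sum_congr (by ext; simp) fun u _ => ?_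
    rw [hcyl, Real.logb, mul_div_assoc]
  · intro u _ hu
    by_contra he
    rw [Set.not_nonempty_iff_eq_empty] at he
    simp [he] at hu

theorem sTerm_eq {Ω : Set (SymbSeq m)} (hΩ : MeasurableSet Ω) (μ : Measure (SymbSeq m))
    [IsProbabilityMeasure μ] (h : μ Ω = 1) (q k : ℕ) :
    sTerm q Ω μ k = (∫ x, info μ k x ∂μ) / Real.log m / (q : ℝ) ^ (k + 1) := by
  rw [sTerm, cylinderEntropy_eq hΩ μ h]

theorem sTerm_nonneg (hm : 2 ≤ m) {Ω : Set (SymbSeq m)} (hΩ : MeasurableSet Ω)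
    (μ : Measure (SymbSeq m)) [IsProbabilityMeasure μ] (h : μ Ω = 1) (q k : ℕ) :
    0 ≤ sTerm q Ω μ k := by
  have hlogm : 0 < Real.log m := Real.log_pos (by exact_mod_cast (by omega : 1 < m))
  rw [sTerm_eq hΩ μ h]
  have : 0 ≤ ∫ x, info μ k x ∂μ := integral_nonneg (info_nonneg μ k)
  positivity

/-- At most `m ^ k` cells give entropy at most `k` in base `m`, so the series is dominated by `∑ k /
q ^ k`. -/
theorem summable_sTerm (hm : 2 ≤ m) {q : ℕ} (hq : 2 ≤ q) {Ω : Set (SymbSeq m)}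
    (hΩ : MeasurableSet Ω) (μ : Measure (SymbSeq m)) [IsProbabilityMeasure μ] (h : μ Ω = 1) :
    Summable fun k : ℕ => sTerm q Ω μ (k + 1) := by
  have hlogm : 0 < Real.log m := Real.log_pos (by exact_mod_cast (by omega : 1 < m))
  have hq1 : (1 : ℝ) < q := by exact_mod_cast (by omega : 1 < q)
  refine (summable_nat_add_iff 1).2 (Summable.of_nonneg_of_le (fun k => sTerm_nonneg hm hΩ μ h q k)
    (f := fun k : ℕ => (k : ℝ) ^ 1 * ((q : ℝ)⁻¹) ^ k) ?_ ?_)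
  · intro k
    rw [sTerm_eq hΩ μ h, pow_one, inv_pow, ← div_eq_mul_inv]
    have h1 : (∫ x, info μ k x ∂μ) / Real.log m ≤ k := by
      rw [div_le_iff₀ hlogm]
      exact integral_info_le μ k
    exact div_le_div₀ (by positivity) h1 (by positivity)
      (pow_le_pow_right₀ hq1.le (Nat.le_succ k))
  · refine summable_pow_mul_geometric_of_norm_lt_one 1 ?_
    rw [Real.norm_of_nonneg (by positivity)]
    exact inv_lt_one_of_one_lt₀ hq1

theorem sDim_nonneg (hm : 2 ≤ m) (q : ℕ) {Ω : Set (SymbSeq m)} (hΩ : MeasurableSet Ω)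
    (μ : Measure (SymbSeq m)) [IsProbabilityMeasure μ] (h : μ Ω = 1) : 0 ≤ sDim q Ω μ :=
  mul_nonneg (sq_nonneg _) (tsum_nonneg fun k => sTerm_nonneg hm hΩ μ h q (k + 1))

theorem pre_eq_ofFn (x : SymbSeq m) (k : ℕ) : pre x k = List.ofFn fun j : Fin k => x j := by
  rw [pre, List.ofFn_eq_map, ← List.map_coe_finRange_eq_range, List.map_map]
  rfl

/-- The value of `s(Ω, μ)` for a measure whose cylinder weights have the form provided by
`exists_optimal_measure`. -/
theorem sDim_eq_of_log_measure_cyl (hm : 2 ≤ m) {q : ℕ} (hq : 2 ≤ q) {Ω : Set (SymbSeq m)}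
    (hΩ : MeasurableSet Ω) (μ : Measure (SymbSeq m)) [IsProbabilityMeasure μ] (h : μ Ω = 1)
    (L : List (Fin m) → ℝ)
    (hL : ∀ x ∈ Ω, ∀ k, 0 ≤ L (pre x k) ∧ L (pre x k) ≤ Real.log m ∧ 0 < μ.real (cyl x k) ∧
      Real.log (μ.real (cyl x k)) =
        ∑ j ∈ Finset.range k, (L (pre x (j + 1)) - q * L (pre x j))) :
    sDim q Ω μ = (q - 1) * L [] / Real.log m := by
  have hlogm : 0 < Real.log m := Real.log_pos (by exact_mod_cast (by omega : 1 < m))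
  have hq1 : (1 : ℝ) < q := by exact_mod_cast (by omega : 1 < q)
  have hae := ae_mem_of_measure_eq_one hΩ h
  have hLint : ∀ k, Integrable (fun x => L (pre x k)) μ := by
    intro k
    simp_rw [pre_eq_ofFn]
    exact integrable_comp_prefix μ k fun u => L (List.ofFn u)
  set a : ℕ → ℝ := fun k => ∫ x, L (pre x k) ∂μ with ha
  have ha0 : ∀ k, 0 ≤ a k := fun k => integral_nonneg_of_ae <| by
    filter_upwards [hae] with x hx using (hL x hx k).1
  have ha1 : ∀ k, a k ≤ Real.log m := by
    intro k
    have := integral_mono_ae (hLint k) (integrable_const (Real.log m)) (by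
      filter_upwards [hae] with x hx using (hL x hx k).2.1)
    simpa using this
  have haz : a 0 = L [] := by simp [ha, pre_zero]
  set e : ℕ → ℝ := fun k => ∫ x, info μ k x ∂μ with he
  have he0 : e 0 = 0 := by simp [he, info, cyl]
  -- Integrating the one-step increment of `log μ` from `hL` links the entropies `e` to the means
  -- `a`; dividing by powers of `q` makes this recursion telescope in `hpart`.
  have hes : ∀ k, e (k + 1) = e k + q * a k - a (k + 1) := by
    intro k
    have h1 : e (k + 1) = ∫ x, (info μ k x + q * L (pre x k) - L (pre x (k + 1))) ∂μ := by
      refine integral_congr_ae ?_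
      filter_upwards [hae] with x hx
      simp only [info]
      rw [(hL x hx (k + 1)).2.2.2, (hL x hx k).2.2.2, Finset.sum_range_succ]
      ring
    rw [h1, integral_sub (f := fun x => info μ k x + q * L (pre x k))
      ((integrable_info μ k).add ((hLint k).const_mul _)) (hLint (k + 1)),
      integral_add (integrable_info μ k) ((hLint k).const_mul _), integral_const_mul]
  have hpart : ∀ K : ℕ, (1 - (q : ℝ)⁻¹) * ∑ k ∈ Finset.range K, e (k + 1) / (q : ℝ) ^ (k + 2) =
      a 0 / q - (q * a K + e K) / (q : ℝ) ^ (K + 2) := by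
    intro K
    induction K with
    | zero => simp only [Finset.range_zero, Finset.sum_empty, he0]; field_simp; ring
    | succ K ih =>
      rw [Finset.sum_range_succ, mul_add, ih, hes K]
      field_simp
      ring
  have hsum := summable_sTerm hm hq hΩ μ h
  have hterm : ∀ k, sTerm q Ω μ (k + 1) = (Real.log m)⁻¹ * (e (k + 1) / (q : ℝ) ^ (k + 2)) := by
    intro k
    rw [sTerm_eq hΩ μ h]
    simp only [he]
    ring
  have hsum' : Summable fun k : ℕ => e (k + 1) / (q : ℝ) ^ (k + 2) := by
    simp_rw [hterm] at hsum
    exact (summable_mul_left_iff (inv_ne_zero hlogm.ne')).1 hsum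
  have hlim1 := (hsum'.hasSum.tendsto_sum_nat).const_mul (1 - (q : ℝ)⁻¹)
  have hpow : Tendsto (fun K : ℕ => ((q : ℝ) ^ (K + 2))⁻¹) atTop (𝓝 0) :=
    tendsto_inv_atTop_zero.comp ((tendsto_pow_atTop_atTop_of_one_lt hq1).comp
      (tendsto_add_atTop_nat 2))
  have hlima : Tendsto (fun K : ℕ => a K / (q : ℝ) ^ (K + 2)) atTop (𝓝 0) := by
    refine squeeze_zero (fun K => by have := ha0 K; positivity) (fun K => ?_)
      (by simpa using hpow.const_mul (Real.log m))
    rw [div_eq_mul_inv]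
    exact mul_le_mul_of_nonneg_right (ha1 K) (by positivity)
  -- No separate growth estimate for `e` is needed: these are, up to a shift and a factor `q⁻¹`, the
  -- terms of a convergent series.
  have hlime : Tendsto (fun K : ℕ => e K / (q : ℝ) ^ (K + 2)) atTop (𝓝 0) := by
    rw [← tendsto_add_atTop_iff_nat 1]
    have := hsum'.tendsto_atTop_zero.mul_const ((q : ℝ)⁻¹)
    rw [zero_mul] at this
    refine this.congr fun K => ?_
    rw [pow_succ _ (K + 2), ← div_eq_mul_inv, div_div]
  have hlim2 : Tendsto (fun K : ℕ => a 0 / q - (q * a K + e K) / (q : ℝ) ^ (K + 2)) atTop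
      (𝓝 (a 0 / q)) := by
    have := (tendsto_const_nhds (x := a 0 / q)).sub ((hlima.const_mul (q : ℝ)).add hlime)
    simp only [mul_zero, add_zero, sub_zero] at this
    refine this.congr fun K => ?_
    ring
  have heq := tendsto_nhds_unique (hlim1.congr hpart) hlim2
  rw [sDim]
  simp_rw [hterm]
  rw [tsum_mul_left, ← haz]
  set S := ∑' k : ℕ, e (k + 1) / (q : ℝ) ^ (k + 2)
  have hS : (q - 1) * S = a 0 := by
    field_simp at heq
    linarith
  rw [← hS]
  field_simp

end SymbSeq

/-! ### The law of large numbers along progressions, and the lower bound. -/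

theorem tendsto_comp_div_div {u : ℕ → ℝ} {l : ℝ} (hu : Tendsto (fun n : ℕ => u n / n) atTop (𝓝 l))
    {c : ℕ} (hc : 0 < c) : Tendsto (fun n : ℕ => u (n / c) / n) atTop (𝓝 (l / c)) := by
  have h1 : Tendsto (fun n : ℕ => n / c) atTop atTop := Nat.tendsto_div_const_atTop hc.ne'
  have h2 : Tendsto (fun n : ℕ => ((n / c : ℕ) : ℝ) / n) atTop (𝓝 ((c : ℝ)⁻¹)) := by
    have := (tendsto_nat_floor_mul_div_atTop (R := ℝ) (a := (c : ℝ)⁻¹) (by positivity)).comp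
      tendsto_natCast_atTop_atTop
    refine this.congr fun n => ?_
    simp only [Function.comp_apply]
    rw [inv_mul_eq_div, Nat.floor_div_eq_div]
  have h3 := (hu.comp h1).mul h2
  rw [← div_eq_mul_inv] at h3
  refine h3.congr' ?_
  filter_upwards [eventually_ge_atTop c] with n hn
  have : (0 : ℝ) < (n / c : ℕ) := by exact_mod_cast Nat.div_pos hn hc
  simp only [Function.comp_apply]
  field_simp

namespace SymbSeq

variable {m : ℕ}

/-- The strong law of large numbers along an injective selection of coordinates of an i.i.d.
sequence. -/
theorem ae_tendsto_sum_comp_div {X : Type*} [MeasurableSpace X] (μ : Measure X)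
    [IsProbabilityMeasure μ] {f : X → ℝ} (hf : Measurable f) (hfi : Integrable f μ) {σ : ℕ → ℕ}
    (hσ : Function.Injective σ) :
    ∀ᵐ y ∂(Measure.infinitePi fun _ : ℕ => μ),
      Tendsto (fun N : ℕ => (∑ i ∈ Finset.range N, f (y (σ i))) / N) atTop
        (𝓝 (∫ x, f x ∂μ)) := by
  have hmp : ∀ i, MeasurePreserving (Function.eval i) (Measure.infinitePi fun _ : ℕ => μ) μ :=
    fun i => measurePreserving_eval_infinitePi (fun _ : ℕ => μ) i
  have hindep := ProbabilityTheory.iIndepFun_infinitePi (P := fun _ : ℕ => μ)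
    (X := fun _ : ℕ => f) (fun _ => hf)
  have h := ProbabilityTheory.strong_law_ae_real
    (μ := Measure.infinitePi fun _ : ℕ => μ) (fun i y => f (y (σ i)))
    ((hmp (σ 0)).integrable_comp_of_integrable hfi)
    (fun i j hij => hindep.indepFun (hσ.ne hij))
    (fun i => by
      refine ⟨(hf.comp (measurable_pi_apply _)).aemeasurable,
        (hf.comp (measurable_pi_apply _)).aemeasurable, ?_⟩
      have hmap : ∀ k, Measure.map (fun y : ℕ → X => f (y k)) (Measure.infinitePi fun _ : ℕ => μ) =
          μ.map f := by
        intro k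
        have := Measure.map_map (μ := Measure.infinitePi fun _ : ℕ => μ) hf (hmp k).measurable
        rw [(hmp k).map_eq] at this
        exact this.symm
      rw [hmap, hmap])
  filter_upwards [h] with y hy
  have hint : ∫ y, f (y (σ 0)) ∂(Measure.infinitePi fun _ : ℕ => μ) = ∫ x, f x ∂μ := by
    have := integral_map (μ := Measure.infinitePi fun _ : ℕ => μ)
      (hmp (σ 0)).measurable.aemeasurable (f := f) hf.aestronglyMeasurable
    rw [(hmp (σ 0)).map_eq] at this
    exact this.symm
  rw [← hint]
  exact hy

/-- Removing the multiples of `q` from all indices leaves two sums along injective enumerations, to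
each of which the strong law applies. -/
theorem sum_progStarts_eq {q : ℕ} (hq : 2 ≤ q) (N : ℕ) (g : ℕ → ℝ) :
    ∑ i ∈ progStarts q N, g i = ∑ i ∈ Finset.range N, g (i + 1) -
      ∑ i ∈ Finset.range (N / q), g (q * (i + 1)) := by
  have h1 : ∑ i ∈ Finset.range N, g (i + 1) = ∑ a ∈ Finset.Icc 1 N, g a := by
    rw [Finset.range_eq_Ico, Finset.sum_Ico_add' g 0 N 1]
    rfl
  have h2 : ∑ i ∈ Finset.range (N / q), g (q * (i + 1)) = ∑ a ∈ Finset.Icc 1 N with q ∣ a, g a := by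
    refine Finset.sum_bij (fun i _ => q * (i + 1)) ?_ ?_ ?_ ?_
    · intro i hi
      rw [Finset.mem_range, Nat.lt_iff_add_one_le, Nat.le_div_iff_mul_le (by omega)] at hi
      rw [Finset.mem_filter, Finset.mem_Icc]
      exact ⟨⟨Nat.mul_pos (by omega) (Nat.succ_pos i), by rw [mul_comm]; exact hi⟩,
        dvd_mul_right _ _⟩
    · intro i _ j _ hij
      have := Nat.eq_of_mul_eq_mul_left (by omega : 0 < q) hij
      omega
    · intro a ha
      rw [Finset.mem_filter, Finset.mem_Icc] at ha
      obtain ⟨⟨h1, h2⟩, b, rfl⟩ := ha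
      have hb : 0 < b := Nat.pos_of_ne_zero (by rintro rfl; simp at h1)
      refine ⟨b - 1, ?_, ?_⟩
      · rw [Finset.mem_range, Nat.lt_iff_add_one_le, Nat.le_div_iff_mul_le (by omega),
          Nat.sub_add_cancel hb, mul_comm]
        exact h2
      · rw [Nat.sub_add_cancel hb]
    · intro _ _
      rfl
  rw [h1, h2, progStarts,
    ← Finset.sum_filter_add_sum_filter_not (Finset.Icc 1 N) (fun a => q ∣ a), add_sub_cancel_left]

theorem ae_tendsto_sum_progStarts {X : Type*} [MeasurableSpace X] {q : ℕ} (hq : 2 ≤ q)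
    (μ : Measure X) [IsProbabilityMeasure μ] {f : X → ℝ} (hf : Measurable f)
    (hfi : Integrable f μ) :
    ∀ᵐ y ∂(Measure.infinitePi fun _ : ℕ => μ),
      Tendsto (fun N : ℕ => (∑ i ∈ progStarts q N, f (y i)) / N) atTop
        (𝓝 ((1 - (q : ℝ)⁻¹) * ∫ x, f x ∂μ)) := by
  filter_upwards [ae_tendsto_sum_comp_div μ hf hfi (σ := fun i => i + 1) (add_left_injective 1),
    ae_tendsto_sum_comp_div μ hf hfi (σ := fun i => q * (i + 1)) (fun i j hij => by
      have := Nat.eq_of_mul_eq_mul_left (by omega : 0 < q) hij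
      omega)] with y h1 h2
  have h3 := h1.sub (tendsto_comp_div_div h2 (by omega : 0 < q))
  have e : (∫ x, f x ∂μ) - (∫ x, f x ∂μ) / q = (1 - (q : ℝ)⁻¹) * ∫ x, f x ∂μ := by ring
  rw [e] at h3
  refine h3.congr fun N => ?_
  rw [sum_progStarts_eq hq N fun i => f (y i), sub_div]

/-- The condition `i ≤ n / q ^ k` says `q ^ k * i ≤ n`, that is, `J_i` has more than `k` terms up to
`n`. Differences of consecutive levels then isolate the exact lengths. -/
theorem progStarts_div_pow {q : ℕ} (hq : 2 ≤ q) (n k : ℕ) :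
    progStarts q (n / q ^ k) = {i ∈ progStarts q n | k < progLength q n i} := by
  ext i
  rw [Finset.mem_filter, mem_progStarts, mem_progStarts,
    Nat.le_div_iff_mul_le (Nat.pow_pos (by omega)), mul_comm i]
  constructor
  · rintro ⟨⟨h1, h2⟩, h3⟩
    have hn : i ≤ n := le_trans (Nat.le_mul_of_pos_left i (Nat.pow_pos (by omega))) h2
    exact ⟨⟨⟨h1, hn⟩, h3⟩, (lt_progLength_iff hq h1 hn k).2 h2⟩
  · rintro ⟨⟨⟨h1, hn⟩, h3⟩, h2⟩
    exact ⟨⟨h1, (lt_progLength_iff hq h1 hn k).1 h2⟩, h3⟩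

/-- Truncation: the progressions of length at most `K` contribute the left side. -/
theorem sum_truncated_le {q : ℕ} (hq : 2 ≤ q) (n K : ℕ) (f : ℕ → ℕ → ℝ)
    (hf : ∀ k i, 0 ≤ f k i) :
    ∑ k ∈ Finset.range K, (∑ i ∈ progStarts q (n / q ^ k), f (k + 1) i -
      ∑ i ∈ progStarts q (n / q ^ (k + 1)), f (k + 1) i) ≤
      ∑ i ∈ progStarts q n, f (progLength q n i) i := by
  simp_rw [progStarts_div_pow hq, Finset.sum_filter, ← Finset.sum_sub_distrib]
  rw [Finset.sum_comm]
  refine Finset.sum_le_sum fun i _ => ?_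
  calc _ = ∑ k ∈ Finset.range K, if k + 1 = progLength q n i then f (progLength q n i) i else 0 := by
        refine Finset.sum_congr rfl fun k _ => ?_
        rcases lt_trichotomy (k + 1) (progLength q n i) with h | h | h
        · rw [if_pos (by omega), if_pos h, if_neg h.ne, sub_self]
        · rw [if_pos (by omega), if_neg (by omega), if_pos h, sub_zero, h]
        · rw [if_neg (by omega), if_neg (by omega), if_neg h.ne', sub_self]
    _ ≤ _ := by
        -- Lengths are never `0`, so the truncated subtraction loses nothing.
        have hs : progLength q n i = progLength q n i - 1 + 1 := rfl
        rw [← Finset.sum_filter]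
        have hsub : {k ∈ Finset.range K | k + 1 = progLength q n i} ⊆ {progLength q n i - 1} := by
          intro k hk
          rw [Finset.mem_filter] at hk
          rw [Finset.mem_singleton]
          omega
        refine (Finset.sum_le_sum_of_subset_of_nonneg hsub fun _ _ _ => hf _ _).trans ?_
        rw [Finset.sum_singleton]

/-- For each length there are finitely many words, so the null cylinders together are null. This
keeps the logarithms meaningful. -/
theorem ae_measureReal_cyl_pos (μ : Measure (SymbSeq m)) [IsProbabilityMeasure μ] :
    ∀ᵐ x ∂μ, ∀ k, 0 < μ.real (cyl x k) := by
  rw [ae_all_iff]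
  intro k
  have h : μ (⋃ u : Fin k → Fin m, ⋃ (_ : μ (wordCylinder u) = 0), wordCylinder u) = 0 :=
    measure_iUnion_null fun u => measure_iUnion_null fun h => h
  refine measure_mono_null (fun x hx => ?_) h
  have h0 : μ.real (cyl x k) = 0 := le_antisymm (not_lt.1 hx) measureReal_nonneg
  rw [measureReal_eq_zero_iff, cyl_eq_wordCylinder] at h0
  exact Set.mem_iUnion.2 ⟨_, Set.mem_iUnion.2 ⟨h0, fun _ => rfl⟩⟩

theorem along_placeOnProgressions {q : ℕ} (hq : 2 ≤ q) (y : ℕ → SymbSeq m) {i : ℕ} (h1 : 1 ≤ i)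
    (hi : ¬ q ∣ i) : along q (placeOnProgressions q y) i = y i := by
  funext l
  have hpos : 0 < i * q ^ l := Nat.mul_pos h1 (Nat.pow_pos (by omega))
  simp only [along, term, placeOnProgressions]
  rw [Nat.sub_add_cancel hpos, mul_comm i, divMaxPow_pow_mul_of_not_dvd hq hi,
    padicValNat_pow_mul_of_not_dvd hq hi]

theorem ae_infinitePi_of_ae {μ : Measure (SymbSeq m)} [IsProbabilityMeasure μ]
    {p : SymbSeq m → Prop} (h : ∀ᵐ x ∂μ, p x) :
    ∀ᵐ y ∂(Measure.infinitePi fun _ : ℕ => μ), ∀ i, p (y i) :=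
  ae_all_iff.2 fun i =>
    (measurePreserving_eval_infinitePi (fun _ : ℕ => μ) i).quasiMeasurePreserving.ae h

theorem measurableSet_multSubshift {Ω : Set (SymbSeq m)} (hΩ : MeasurableSet Ω) (q : ℕ) :
    MeasurableSet (multSubshift q Ω) := by
  simp only [multSubshift, Set.ofPred_forall]
  refine MeasurableSet.iInter fun i => MeasurableSet.iInter fun _ => MeasurableSet.iInter fun _ => ?_
  have : Measurable fun x : SymbSeq m => (fun l => x.term (i * q ^ l) : SymbSeq m) :=
    measurable_pi_lambda _ fun l => measurable_pi_apply _
  exact this hΩ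

theorem multMeasure_multSubshift {q : ℕ} (hq : 2 ≤ q) {Ω : Set (SymbSeq m)} (hΩ : MeasurableSet Ω)
    (μ : Measure (SymbSeq m)) [IsProbabilityMeasure μ] (h : μ Ω = 1) :
    multMeasure q μ (multSubshift q Ω) = 1 := by
  have hX := measurableSet_multSubshift hΩ q
  rw [← prob_compl_eq_zero_iff hX]
  refine (ae_map_iff (p := fun x => x ∈ multSubshift q Ω)
    (measurable_placeOnProgressions q).aemeasurable hX).2 ?_
  filter_upwards [ae_infinitePi_of_ae (ae_mem_of_measure_eq_one hΩ h)] with y hy i h1 hi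
  have := hy i
  rwa [← along_placeOnProgressions hq y h1 hi] at this

/-- Almost surely, `-log P_μ [x_1 … x_n]` eventually exceeds `n d log m`, for every `d < s(Ω, μ)`. -/
theorem ae_eventually_multMeasure_cyl_le (hm : 2 ≤ m) {q : ℕ} (hq : 2 ≤ q) {Ω : Set (SymbSeq m)}
    (hΩ : MeasurableSet Ω) (μ : Measure (SymbSeq m)) [IsProbabilityMeasure μ] (h : μ Ω = 1)
    (d : ℝ≥0) (hd : (d : ℝ) < sDim q Ω μ) :
    ∀ᵐ x ∂(multMeasure q μ), ∀ᶠ n in atTop,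
      multMeasure q μ (cyl x n) ≤ (((m : ℝ≥0∞)⁻¹) ^ n) ^ (d : ℝ) := by
  have hlogm : 0 < Real.log m := Real.log_pos (by exact_mod_cast (by omega : 1 < m))
  have hq0 : (0 : ℝ) < q := by positivity
  refine (ae_map_iff (measurable_placeOnProgressions q).aemeasurable ?_).2 ?_
  · simp only [eventually_atTop, Set.ofPred_exists, Set.ofPred_forall]
    exact MeasurableSet.iUnion fun N => MeasurableSet.iInter fun n => MeasurableSet.iInter fun _ =>
      measurableSet_le (measurable_measure_cyl _ n) measurable_const
  have hlim := ((summable_sTerm hm hq hΩ μ h).hasSum.tendsto_sum_nat).const_mul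
    (((q : ℝ) - 1) ^ 2)
  -- Truncating the series at `K` still leaves more than `d`, so the strong law is needed for only
  -- finitely many lengths.
  obtain ⟨K, hK⟩ := (hlim.eventually (lt_mem_nhds hd)).exists
  filter_upwards [ae_infinitePi_of_ae (ae_measureReal_cyl_pos μ),
    ae_all_iff.2 fun k => ae_tendsto_sum_progStarts hq μ (measurable_info μ k)
      (integrable_info μ k)] with y hpos hslln
  set x := placeOnProgressions q y with hx
  have hxy : ∀ n, ∀ i ∈ progStarts q n, along q x i = y i := by
    intro n i hi
    obtain ⟨⟨h1, -⟩, h2⟩ := mem_progStarts.1 hi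
    exact along_placeOnProgressions hq y h1 h2
  have hlog := fun n => log_multMeasure_cyl hq μ x n fun i hi => by
    rw [hxy n i hi]
    exact hpos i _
  let B : ℕ → ℝ := fun n => ∑ k ∈ Finset.range K,
    (∑ i ∈ progStarts q (n / q ^ k), info μ (k + 1) (y i) -
      ∑ i ∈ progStarts q (n / q ^ (k + 1)), info μ (k + 1) (y i))
  have hB : Tendsto (fun n : ℕ => B n / n) atTop (𝓝 (Real.log m *
      ((q - 1) ^ 2 * ∑ k ∈ Finset.range K, sTerm q Ω μ (k + 1)))) := by
    have hk : ∀ k : ℕ, Tendsto (fun n : ℕ =>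
        (∑ i ∈ progStarts q (n / q ^ k), info μ (k + 1) (y i)) / n -
          (∑ i ∈ progStarts q (n / q ^ (k + 1)), info μ (k + 1) (y i)) / n) atTop
        (𝓝 (Real.log m * ((q - 1) ^ 2 * sTerm q Ω μ (k + 1)))) := by
      intro k
      have := (tendsto_comp_div_div (hslln (k + 1)) (Nat.pow_pos (n := k) (by omega : 0 < q))).sub
        (tendsto_comp_div_div (hslln (k + 1)) (Nat.pow_pos (n := k + 1) (by omega : 0 < q)))
      -- The limiting density is `(1 - 1/q) (1/q^k - 1/q^(k+1)) = (q-1)²/q^(k+2)`, the weight of the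
      -- block entropy of length `k + 1`.
      convert this using 2
      rw [sTerm_eq hΩ μ h]
      push_cast
      field_simp
      ring
    have := tendsto_finsetSum (Finset.range K) fun k _ => hk k
    simp only [← Finset.mul_sum] at this
    refine this.congr fun n => ?_
    simp only [B, Finset.sum_div, sub_div]
  have hev : ∀ᶠ n : ℕ in atTop, Real.log m * d < B n / n :=
    hB.eventually (lt_mem_nhds (mul_lt_mul_of_pos_left hK hlogm))
  filter_upwards [hev, eventually_gt_atTop 0] with n hn hn0
  have hn0' : (0 : ℝ) < n := by exact_mod_cast hn0
  rw [le_pow_rpow_iff hm n d _ x (hlog n).1, (hlog n).2]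
  have hle := sum_truncated_le hq n K (fun k i => info μ k (y i)) fun k i => info_nonneg μ k (y i)
  have hsum : ∑ i ∈ progStarts q n, Real.log (μ.real (cyl (along q x i) (progLength q n i))) =
      -∑ i ∈ progStarts q n, info μ (progLength q n i) (y i) := by
    rw [← Finset.sum_neg_distrib]
    refine Finset.sum_congr rfl fun i hi => ?_
    rw [hxy n i hi, info, neg_neg]
  rw [hsum, neg_le_neg_iff]
  rw [lt_div_iff₀ hn0'] at hn
  change B n ≤ _ at hle
  linarith

theorem sDim_le_measureDimH (hm : 2 ≤ m) {q : ℕ} (hq : 2 ≤ q) {Ω : Set (SymbSeq m)}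
    (hΩ : MeasurableSet Ω) (μ : Measure (SymbSeq m)) [IsProbabilityMeasure μ] (h : μ Ω = 1) :
    ENNReal.ofReal (sDim q Ω μ) ≤ measureDimH (multMeasure q μ) := by
  refine le_iInf fun F => le_iInf fun hF => le_iInf fun hF1 => ?_
  refine ENNReal.le_of_forall_nnreal_lt fun d hd => ?_
  refine le_dimH_of_measure_cyl_le hm (multMeasure q μ) hF hF1 d
    (ae_eventually_multMeasure_cyl_le hm hq hΩ μ h d ?_)
  rwa [ENNReal.ofReal, ENNReal.coe_lt_coe, Real.lt_toNNReal_iff_coe_lt] at hd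

end SymbSeq

/-! ### The cycle of inequalities. -/

open SymbSeq

theorem proposition2p4 (m q : ℕ) (hm : 2 ≤ m) (hq : 2 ≤ q)
    (Ω : Set (SymbSeq m)) (hΩ : IsClosed Ω) :
    (∀ μ ∈ probMeasuresOn Ω,
      Summable (fun k : ℕ => sTerm q Ω (μ : Measure (SymbSeq m)) (k + 1)) ∧
        0 ≤ sDim q Ω (μ : Measure (SymbSeq m))) ∧
    (dimH (multSubshift q Ω) =
      ⨆ μ ∈ probMeasuresOn Ω, measureDimH (multMeasure q (μ : Measure (SymbSeq m)))) ∧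
    ((⨆ μ ∈ probMeasuresOn Ω, measureDimH (multMeasure q (μ : Measure (SymbSeq m)))) =
      ⨆ μ ∈ probMeasuresOn Ω, ENNReal.ofReal (sDim q Ω (μ : Measure (SymbSeq m)))) := by
  have hΩm : MeasurableSet Ω := hΩ.measurableSet
  have hsP : (⨆ μ ∈ probMeasuresOn Ω, ENNReal.ofReal (sDim q Ω (μ : Measure (SymbSeq m)))) ≤
      ⨆ μ ∈ probMeasuresOn Ω, measureDimH (multMeasure q (μ : Measure (SymbSeq m))) :=
    iSup₂_mono fun μ hμ => sDim_le_measureDimH hm hq hΩm μ hμ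
  have hPX : (⨆ μ ∈ probMeasuresOn Ω, measureDimH (multMeasure q (μ : Measure (SymbSeq m)))) ≤
      dimH (multSubshift q Ω) :=
    iSup₂_le fun μ hμ => iInf_le_of_le _ <| iInf_le_of_le (measurableSet_multSubshift hΩm q) <|
      iInf_le _ (multMeasure_multSubshift hq hΩm μ hμ)
  have hXs : dimH (multSubshift q Ω) ≤
      ⨆ μ ∈ probMeasuresOn Ω, ENNReal.ofReal (sDim q Ω (μ : Measure (SymbSeq m))) := by
    -- The empty case is separate because it admits no probability measure; the progression `i = 1`
    -- then rules out any point of the subshift.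
    rcases Ω.eq_empty_or_nonempty with rfl | hne
    · have : multSubshift q (∅ : Set (SymbSeq m)) = ∅ :=
        Set.eq_empty_of_forall_notMem fun x hx => hx 1 le_rfl (by rw [Nat.dvd_one]; omega)
      rw [this, dimH_empty]
      exact bot_le
    · obtain ⟨μ, hμ, L, hL⟩ := exists_optimal_measure hq hΩ hne
      refine le_trans ?_ (le_iSup₂ μ hμ)
      rw [sDim_eq_of_log_measure_cyl hm hq hΩm μ hμ L hL]
      exact dimH_multSubshift_le hm hq μ L hL
  exact ⟨fun μ hμ => ⟨summable_sTerm hm hq hΩm μ hμ, sDim_nonneg hm q hΩm μ hμ⟩,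
    le_antisymm (hXs.trans hsP) hPX, le_antisymm (hPX.trans hXs) hsP⟩
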